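/- Let $d\ge 1$, $\alpha\in(1,2)$ and $T>0$. Let $(L_t)_{t\ge 0}$ be the $d$-dimensional symmetric, rotationally invariant $\alpha$-stable process with Lévy measure $|z|^{-d-\alpha}\,dz$, that is, the càdlàg Lévy process with $L_0=0$ a.s. and $$\mathbb E\,e^{i\xi\cdot L_t}=e^{t\psi(\xi)},\qquad \psi(\xi)=\int_{\mathbb R^d}\bigl(e^{i\xi\cdot z}-1-i\,\xi\cdot z\,\mathbf 1_{|z|\le 1}\bigr)\frac{dz}{|z|^{d+\alpha}},$$ and for $t>0$ let $p_\alpha(t,z)=(2\pi)^{-d}\int_{\mathbb R^d}e^{-iz\cdot\xi}\,e^{t\psi(\xi)}\,d\xi$ be the continuous density of $L_t$. Let $b:[0,\infty)\times\mathbb R^d\to\mathbb R^d$ be bounded and Borel measurable, and write $\|b\|_\infty=\sup_{s\ge 0,\,x\in\mathbb R^d}|b(s,x)|$. For an integer $N\ge 1$ put $h=T/N$ and $\phi_N(s)=kh$ for $s\in[kh,(k+1)h)$. For $x\in\mathbb R^d$ let $X^N(x)$ be the Euler scheme given by $X^N_0(x)=x$ and $$X^N_t(x)=x+\int_0^t b\bigl(s,X^N_{\phi_N(s)}(x)\bigr)\,ds+L_t,\qquad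 t\in(0,T].$$ Then for every $N\ge 1$, $t\in(0,T]$ and $x\in\mathbb R^d$ the random variable $X^N_t(x)$ has a continuous density $p^N_x(t,\cdot)$ with respect to Lebesgue measure, and there is a constant $c>0$, depending only on $d$, $\alpha$, $T$ and $\|b\|_\infty$ (it can be chosen uniformly over all $b$ with $\|b\|_\infty\le K$, for each $K\ge 0$), such that $$p^N_x(t,y)\le c\,p_\alpha(t,x-y)\qquad\text{for all }N\ge 1,\ t\in(0,T],\ x,y\in\mathbb R^d.$$ -/

import Mathlib

open MeasureTheory ProbabilityTheory Filter Topology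
open scoped NNReal ENNReal RealInnerProductSpace

noncomputable section

/-- A càdlàg path: right-continuous with left limits at every time. -/
def IsCadlagPath {E : Type*} [TopologicalSpace E] (f : ℝ≥0 → E) : Prop :=
  ∀ t : ℝ≥0, ContinuousWithinAt f (Set.Ici t) t ∧ ∃ l : E, Tendsto f (𝓝[<] t) (𝓝 l)

/-- A Lévy process on `ℝ^d`: a process with càdlàg paths, started from `0`, with independent and
stationary increments. -/
structure IsLevyProcess {d : ℕ} {Ω : Type*} [MeasurableSpace Ω]
    (L : ℝ≥0 → Ω → EuclideanSpace ℝ (Fin d)) (P : Measure Ω) : Prop where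
  measurable : ∀ t, Measurable (L t)
  cadlag : ∀ᵐ ω ∂P, IsCadlagPath (fun t => L t ω)
  zero : ∀ᵐ ω ∂P, L 0 ω = 0
  indep : HasIndepIncrements L P
  stationary : ∀ s t : ℝ≥0, IdentDistrib (fun ω => L (s + t) ω - L s ω) (L t) P P

/-- The Lévy–Khintchine exponent of the triplet `(0, ν, 0)`: no Gaussian part, Lévy measure `ν`,
and no drift relative to the truncation `1_{|z| ≤ 1}`. -/
def levyExponent {d : ℕ} (ν : Measure (EuclideanSpace ℝ (Fin d)))
    (ξ : EuclideanSpace ℝ (Fin d)) : ℂ :=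
  ∫ z, (Complex.exp (Complex.I * (⟪ξ, z⟫ : ℝ)) - 1
    - (if ‖z‖ ≤ 1 then Complex.I * (⟪ξ, z⟫ : ℝ) else 0)) ∂ν

/-- The measure `ν(dz) = |z|^{-d-α} dz` on `ℝ^d`. -/
def stableLevyMeasure (d : ℕ) (α : ℝ) : Measure (EuclideanSpace ℝ (Fin d)) :=
  volume.withDensity fun z => ENNReal.ofReal (‖z‖ ^ (-(d : ℝ) - α))

/-- The symmetric, rotationally invariant `α`-stable process: the Lévy process with Lévy measure
`|z|^{-d-α} dz`, no Gaussian part and no drift (equivalently, with generator `Δ^{α/2}`). -/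
structure IsStableProcess {d : ℕ} (α : ℝ) {Ω : Type*} [MeasurableSpace Ω]
    (L : ℝ≥0 → Ω → EuclideanSpace ℝ (Fin d)) (P : Measure Ω) : Prop
    extends IsLevyProcess L P where
  charFun_eq : ∀ (t : ℝ≥0) (ξ : EuclideanSpace ℝ (Fin d)),
    charFun (P.map (L t)) ξ = Complex.exp ((t : ℝ) * levyExponent (stableLevyMeasure d α) ξ)

/-- The density `p_α(t, ·)` of the `α`-stable process at time `t > 0`, by Fourier inversion of its
characteristic function. The integral is real, since the exponent is even in `ξ`. -/
def stableDensity (d : ℕ) (α : ℝ) (t : ℝ≥0) (x : EuclideanSpace ℝ (Fin d)) : ℝ :=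
  ((2 * Real.pi) ^ d)⁻¹ *
    (∫ ξ : EuclideanSpace ℝ (Fin d), Complex.exp (-(Complex.I * (⟪x, ξ⟫ : ℝ)))
      * Complex.exp ((t : ℝ) * levyExponent (stableLevyMeasure d α) ξ)).re

/-- `φ_N(s) = k h` for `s ∈ [k h, (k+1) h)`, where `h = T / N`. -/
def gridFloor (T : ℝ≥0) (N : ℕ) (s : ℝ≥0) : ℝ≥0 :=
  (⌊s / (T / (N : ℝ≥0))⌋₊ : ℝ≥0) * (T / (N : ℝ≥0))

/-- `X` is the Euler scheme with `N` steps on `[0, T]`, started from `x`, for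
`dX = b(t, X) dt + dL`. -/
structure IsEulerScheme {d : ℕ} {Ω : Type*} [MeasurableSpace Ω] (P : Measure Ω)
    (b : ℝ≥0 → EuclideanSpace ℝ (Fin d) → EuclideanSpace ℝ (Fin d))
    (L : ℝ≥0 → Ω → EuclideanSpace ℝ (Fin d)) (T : ℝ≥0) (N : ℕ)
    (x : EuclideanSpace ℝ (Fin d)) (X : ℝ≥0 → Ω → EuclideanSpace ℝ (Fin d)) : Prop where
  init : ∀ᵐ ω ∂P, X 0 ω = x
  eqn : ∀ t : ℝ≥0, 0 < t → t ≤ T → ∀ᵐ ω ∂P,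
    X t ω = x + (∫ s in (0 : ℝ)..(t : ℝ), b s.toNNReal (X (gridFloor T N s.toNNReal) ω)) + L t ω

end

/-!
The density `p t` of the rotationally invariant stable process has a logarithm that is Lipschitz
with constant of order `t ^ (-1 / α)`:
`p t (x + v) ≤ exp (A t ^ (-1 / α) |v|) p t x` (`exists_stableDensity_add_le`). Given this, the
density bound for the Euler scheme needs neither a parametrix expansion nor Gronwall's lemma.

Fix the final time `t` and let `μ k` be the law of the scheme at the grid time `τ k < t`. Consider
`Q k = ∫ p (t - τ k) (y - z) ∂(μ k) z`, the density at `y` if the drift is switched off after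
`τ k`. By the semigroup property, passing from `Q k` to `Q (k + 1)` only shifts `z` by the drift
increment over `[τ k, τ (k + 1)]`, of norm at most `K (τ (k + 1) - τ k)`. Hence
`Q (k + 1) ≤ exp (A K (τ (k + 1) - τ k) (t - τ k) ^ (-1 / α)) Q k`. As `α > 1`, the exponents sum to
at most `A K ∫₀ᵗ u ^ (-1 / α) du < ∞`, whatever the grid, while `Q 0 = p t (y - x)`. The last step
of this chain is the density of the scheme itself
(`IsStableProcess.integral_stableDensity_chain_le`).

For the Lipschitz bound, `p t` is written as the convolution of a probability measure with the
explicit density `c exp (-√τ |w|)`, whose logarithm is `√τ`-Lipschitz; convolution with a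
probability measure preserves this. The characteristic function of the explicit density is
`(1 + |ξ|² / τ) ^ (-(d + 1) / 2)`, that of a variance-gamma law, which is infinitely divisible. Its
Lévy density is at most a multiple of `τ ^ (-α / 2) |z| ^ (-d - α)`
(`exists_varianceGammaDensity_le`), hence at most the Lévy density `t |z| ^ (-d - α)` of the stable
law for some `τ` of order `t ^ (-2 / α)`, and the difference of the two is again a Lévy density. The
argument runs on characteristic functions, through the class `LogLipTransform`, which is closed
under multiplication by characteristic functions, hence by those of compound Poisson laws, and
under dominated limits.
-/

/-! ### Transforms with Lipschitz logarithm -/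

section Transform

variable {V : Type*} [NormedAddCommGroup V] [InnerProductSpace ℝ V] [FiniteDimensional ℝ V]
  [MeasurableSpace V] [BorelSpace V]

/-- The inverse Fourier transform of a characteristic function, without the factor `(2π)^{-d}`:
if `Φ` is the integrable characteristic function of a law, this is `(2π)^d` times its density. -/
noncomputable def invCharTransform (Φ : V → ℂ) (w : V) : ℂ :=
  ∫ ξ, Complex.exp (-(Complex.I * (⟪w, ξ⟫ : ℝ))) * Φ ξ

/-- The transform of the integrable function `Φ` is real and nonnegative, its logarithm is
`κ`-Lipschitz (written multiplicatively, so that zeros are allowed), and its integral is at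
most `C`. -/
structure LogLipTransform (κ : ℝ) (C : ℝ≥0∞) (Φ : V → ℂ) : Prop where
  integrable : Integrable Φ
  im_eq_zero : ∀ w, (invCharTransform Φ w).im = 0
  nonneg : ∀ w, 0 ≤ (invCharTransform Φ w).re
  growth : ∀ w v, (invCharTransform Φ (w + v)).re
    ≤ Real.exp (κ * ‖v‖) * (invCharTransform Φ w).re
  lintegral_le : ∫⁻ w, ENNReal.ofReal (invCharTransform Φ w).re ≤ C

lemma norm_cexp_neg_I_mul (x : ℝ) : ‖Complex.exp (-(Complex.I * (x : ℝ)))‖ = 1 := by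
  rw [show -(Complex.I * (x : ℂ)) = ((-x : ℝ) : ℂ) * Complex.I by push_cast; ring,
    Complex.norm_exp_ofReal_mul_I]

lemma integrable_cexp_mul {Φ : V → ℂ} (hΦ : Integrable Φ) (w : V) :
    Integrable fun ξ => Complex.exp (-(Complex.I * (⟪w, ξ⟫ : ℝ))) * Φ ξ := by
  refine hΦ.bdd_mul (c := 1) (Continuous.aestronglyMeasurable (by fun_prop)) ?_
  exact ae_of_all _ fun ξ => (norm_cexp_neg_I_mul _).le

lemma norm_invCharTransform_le (Φ : V → ℂ) (w : V) :
    ‖invCharTransform Φ w‖ ≤ ∫ ξ, ‖Φ ξ‖ := by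
  refine (norm_integral_le_integral_norm _).trans_eq ?_
  simp only [norm_mul, norm_cexp_neg_I_mul, one_mul]

lemma continuous_invCharTransform {Φ : V → ℂ} (hΦ : Integrable Φ) :
    Continuous (invCharTransform Φ) := by
  refine continuous_of_dominated (bound := fun ξ => ‖Φ ξ‖) ?_ ?_ hΦ.norm ?_
  · exact fun w => (integrable_cexp_mul hΦ w).aestronglyMeasurable
  · exact fun w => ae_of_all _ fun ξ => by rw [norm_mul, norm_cexp_neg_I_mul, one_mul]
  · exact ae_of_all _ fun ξ => by fun_prop

lemma integrable_invCharTransform_sub {Φ : V → ℂ} (hΦ : Integrable Φ) (μ : Measure V)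
    [IsFiniteMeasure μ] (w : V) : Integrable (fun z => invCharTransform Φ (w - z)) μ := by
  refine Integrable.of_bound (C := ∫ ξ, ‖Φ ξ‖) ?_ (ae_of_all _ fun z => ?_)
  · exact ((continuous_invCharTransform hΦ).comp (by fun_prop)).aestronglyMeasurable
  · exact norm_invCharTransform_le _ _

/-- Multiplying by the characteristic function of `μ` amounts to convolving with `μ`. -/
lemma invCharTransform_mul_charFun {Φ : V → ℂ} (hΦ : Integrable Φ) (μ : Measure V)
    [IsFiniteMeasure μ] (w : V) :
    invCharTransform (fun ξ => Φ ξ * charFun μ ξ) w = ∫ z, invCharTransform Φ (w - z) ∂μ := by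
  have hint : Integrable (Function.uncurry fun ξ z : V =>
      Complex.exp (-(Complex.I * (⟪w - z, ξ⟫ : ℝ))) * Φ ξ) (volume.prod μ) := by
    refine (hΦ.comp_fst μ).bdd_mul (c := 1) (Continuous.aestronglyMeasurable (by fun_prop)) ?_
    exact ae_of_all _ fun p => (norm_cexp_neg_I_mul _).le
  unfold invCharTransform
  rw [← integral_integral_swap hint]
  refine integral_congr_ae (ae_of_all _ fun ξ => ?_)
  simp only [charFun_apply, ← integral_const_mul]
  refine integral_congr_ae (ae_of_all _ fun z => ?_)
  simp only [inner_sub_left]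
  push_cast
  rw [show -(Complex.I * ((⟪w, ξ⟫ : ℝ) - (⟪z, ξ⟫ : ℝ) : ℂ))
    = -(Complex.I * (⟪w, ξ⟫ : ℝ)) + (⟪z, ξ⟫ : ℝ) * Complex.I by ring, Complex.exp_add]
  ring

namespace LogLipTransform

variable {κ : ℝ} {C : ℝ≥0∞} {Φ : V → ℂ}

lemma ofReal_re (h : LogLipTransform κ C Φ) (w : V) :
    (((invCharTransform Φ w).re : ℝ) : ℂ) = invCharTransform Φ w :=
  Complex.ext rfl (h.im_eq_zero w).symm

lemma continuous_re (h : LogLipTransform κ C Φ) :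
    Continuous fun w => (invCharTransform Φ w).re :=
  Complex.continuous_re.comp (continuous_invCharTransform h.integrable)

lemma integrable_re_sub (h : LogLipTransform κ C Φ) (μ : Measure V) [IsFiniteMeasure μ] (w : V) :
    Integrable (fun z => (invCharTransform Φ (w - z)).re) μ :=
  (integrable_invCharTransform_sub h.integrable μ w).re

lemma invCharTransform_mul_charFun_eq (h : LogLipTransform κ C Φ) (μ : Measure V)
    [IsFiniteMeasure μ] (w : V) :
    invCharTransform (fun ξ => Φ ξ * charFun μ ξ) w
      = ((∫ z, (invCharTransform Φ (w - z)).re ∂μ : ℝ) : ℂ) := by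
  rw [invCharTransform_mul_charFun h.integrable, ← integral_complex_ofReal]
  simp only [h.ofReal_re]

lemma mul_charFun (h : LogLipTransform κ C Φ) (μ : Measure V) [IsProbabilityMeasure μ] :
    LogLipTransform κ C (fun ξ => Φ ξ * charFun μ ξ) where
  integrable := by
    refine h.integrable.mul_bdd (c := 1) measurable_charFun.aestronglyMeasurable ?_
    exact ae_of_all _ fun ξ => norm_charFun_le_one ξ
  im_eq_zero w := by rw [h.invCharTransform_mul_charFun_eq, Complex.ofReal_im]
  nonneg w := by
    rw [h.invCharTransform_mul_charFun_eq, Complex.ofReal_re]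
    exact integral_nonneg fun z => h.nonneg _
  growth w v := by
    simp only [h.invCharTransform_mul_charFun_eq, Complex.ofReal_re]
    rw [← integral_const_mul]
    refine integral_mono (h.integrable_re_sub μ _) ((h.integrable_re_sub μ _).const_mul _)
      fun z => ?_
    have := h.growth (w - z) v
    rwa [show w - z + v = w + v - z by abel] at this
  lintegral_le := by
    have hc := h.continuous_re
    calc ∫⁻ w, ENNReal.ofReal (invCharTransform (fun ξ => Φ ξ * charFun μ ξ) w).re
        = ∫⁻ w, (∫⁻ z, ENNReal.ofReal (invCharTransform Φ (w - z)).re ∂μ) := by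
          refine lintegral_congr fun w => ?_
          rw [h.invCharTransform_mul_charFun_eq, Complex.ofReal_re]
          exact ofReal_integral_eq_lintegral_ofReal (h.integrable_re_sub μ w)
            (ae_of_all _ fun z => h.nonneg _)
      _ = ∫⁻ z, (∫⁻ w, ENNReal.ofReal (invCharTransform Φ (w - z)).re) ∂μ := by
          refine lintegral_lintegral_swap (Measurable.aemeasurable ?_)
          exact (ENNReal.measurable_ofReal.comp (hc.measurable)).comp
            (measurable_fst.sub measurable_snd)
      _ = ∫⁻ _, (∫⁻ w, ENNReal.ofReal (invCharTransform Φ w).re) ∂μ := by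
          refine lintegral_congr fun z => ?_
          exact lintegral_sub_right_eq_self (fun w => ENNReal.ofReal (invCharTransform Φ w).re) z
      _ ≤ ∫⁻ _, C ∂μ := lintegral_mono fun z => h.lintegral_le
      _ = C := by simp

lemma mul_charFun_pow (h : LogLipTransform κ C Φ) (μ : Measure V) [IsProbabilityMeasure μ]
    (n : ℕ) : LogLipTransform κ C (fun ξ => Φ ξ * charFun μ ξ ^ n) := by
  induction n with
  | zero => simpa using h
  | succ n ih => simpa only [pow_succ, mul_assoc] using ih.mul_charFun μ

/-- Closure under dominated limits; the bound on the integral passes to the limit by Fatou. -/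
lemma of_tendsto {F : ℕ → V → ℂ} {g : V → ℝ} (hF : ∀ n, LogLipTransform κ C (F n))
    (hg : Integrable g) (hFg : ∀ n ξ, ‖F n ξ‖ ≤ g ξ)
    (hlim : ∀ ξ, Tendsto (fun n => F n ξ) atTop (𝓝 (Φ ξ))) : LogLipTransform κ C Φ := by
  have hconv (w : V) : Tendsto (fun n => invCharTransform (F n) w) atTop
      (𝓝 (invCharTransform Φ w)) := by
    refine tendsto_integral_of_dominated_convergence g ?_ hg ?_ ?_
    · exact fun n => (integrable_cexp_mul (hF n).integrable w).aestronglyMeasurable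
    · exact fun n => ae_of_all _ fun ξ => by
        rw [norm_mul, norm_cexp_neg_I_mul, one_mul]; exact hFg n ξ
    · exact ae_of_all _ fun ξ => (hlim ξ).const_mul _
  have hre (w : V) := (Complex.continuous_re.tendsto _).comp (hconv w)
  have him (w : V) := (Complex.continuous_im.tendsto _).comp (hconv w)
  refine ⟨?_, fun w => ?_, fun w => ?_, fun w v => ?_, ?_⟩
  · refine hg.mono' ?_ (ae_of_all _ fun ξ => ?_)
    · exact aestronglyMeasurable_of_tendsto_ae atTop
        (fun n => (hF n).integrable.aestronglyMeasurable) (ae_of_all _ hlim)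
    · exact le_of_tendsto (hlim ξ).norm (Eventually.of_forall fun n => hFg n ξ)
  · refine tendsto_nhds_unique (him w) (tendsto_const_nhds.congr fun n => ?_)
    exact ((hF n).im_eq_zero w).symm
  · exact ge_of_tendsto' (hre w) fun n => (hF n).nonneg w
  · exact le_of_tendsto_of_tendsto' (hre (w + v)) ((hre w).const_mul _)
      fun n => (hF n).growth w v
  · calc ∫⁻ w, ENNReal.ofReal (invCharTransform Φ w).re
        = ∫⁻ w, liminf (fun n => ENNReal.ofReal (invCharTransform (F n) w).re) atTop := by
          refine lintegral_congr fun w => ?_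
          exact ((ENNReal.continuous_ofReal.tendsto _).comp (hre w)).liminf_eq.symm
      _ ≤ liminf (fun n => ∫⁻ w, ENNReal.ofReal (invCharTransform (F n) w).re) atTop :=
          lintegral_liminf_le fun n => ENNReal.measurable_ofReal.comp
            (hF n).continuous_re.measurable
      _ ≤ C := by
          refine liminf_le_of_frequently_le' (Frequently.of_forall fun n => (hF n).lintegral_le)

/-- Convolution with a compound Poisson law, obtained as a limit of convolution powers of the
laws `(1 - λ/n) δ₀ + ρ/n`, where `λ` is the mass of `ρ`. -/
lemma mul_exp (h : LogLipTransform κ C Φ) (ρ : Measure V) [IsFiniteMeasure ρ] :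
    LogLipTransform κ C
      (fun ξ => Φ ξ * Complex.exp (charFun ρ ξ - (ρ.real Set.univ : ℝ))) := by
  obtain ⟨n₀, hn₀⟩ := exists_nat_ge (ρ.real Set.univ)
  set l := ρ.real Set.univ with hl
  have hl0 : 0 ≤ l := measureReal_nonneg
  -- starting beyond the mass `l` keeps the weight `1 - l / N n` nonnegative
  let N : ℕ → ℕ := fun n => n + n₀ + 1
  have hN (n : ℕ) : l ≤ N n := hn₀.trans (by simp only [N]; push_cast; linarith)
  have hNpos (n : ℕ) : (0 : ℝ) < N n := by simp only [N]; positivity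
  let μ : ℕ → Measure V := fun n =>
    ENNReal.ofReal (1 - l / N n) • Measure.dirac 0 + ENNReal.ofReal (1 / N n) • ρ
  have hle (n : ℕ) : 0 ≤ 1 - l / N n := by
    rw [sub_nonneg, div_le_one (hNpos n)]; exact hN n
  have hμ (n : ℕ) : IsProbabilityMeasure (μ n) := by
    constructor
    simp only [μ, Measure.add_apply, Measure.smul_apply, smul_eq_mul, measure_univ, mul_one]
    rw [← ofReal_measureReal (μ := ρ), ← hl, ← ENNReal.ofReal_mul (by positivity),
      ← ENNReal.ofReal_add (hle n) (by positivity)]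
    rw [show 1 - l / N n + 1 / N n * l = 1 by ring, ENNReal.ofReal_one]
  have hchar (n : ℕ) (ξ : V) : charFun (μ n) ξ = 1 + (charFun ρ ξ - l) / (N n) := by
    have hb (ν : Measure V) [IsFiniteMeasure ν] :
        Integrable (fun x : V => Complex.exp ((⟪x, ξ⟫ : ℝ) * Complex.I)) ν := by
      refine Integrable.of_bound (C := 1) (Continuous.aestronglyMeasurable (by fun_prop)) ?_
      exact ae_of_all _ fun x => (Complex.norm_exp_ofReal_mul_I _).le
    have e1 : Integrable (fun x : V => Complex.exp ((⟪x, ξ⟫ : ℝ) * Complex.I))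
        (ENNReal.ofReal (1 - l / N n) • Measure.dirac 0) :=
      (hb _).smul_measure ENNReal.ofReal_ne_top
    have e2 : Integrable (fun x : V => Complex.exp ((⟪x, ξ⟫ : ℝ) * Complex.I))
        (ENNReal.ofReal (1 / N n) • ρ) := (hb _).smul_measure ENNReal.ofReal_ne_top
    simp only [charFun_apply, μ]
    rw [integral_add_measure e1 e2, integral_smul_measure, integral_smul_measure, integral_dirac,
      ENNReal.toReal_ofReal (hle n), ENNReal.toReal_ofReal (by positivity)]
    simp only [inner_zero_left, Complex.ofReal_zero, zero_mul, Complex.exp_zero,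
      Complex.real_smul]
    push_cast
    ring
  refine of_tendsto (F := fun n ξ => Φ ξ * charFun (μ n) ξ ^ N n) (g := fun ξ => ‖Φ ξ‖)
    (fun n => h.mul_charFun_pow (μ n) (N n)) h.integrable.norm (fun n ξ => ?_) (fun ξ => ?_)
  · rw [norm_mul, norm_pow]
    exact mul_le_of_le_one_right (norm_nonneg _)
      (pow_le_one₀ (norm_nonneg _) (norm_charFun_le_one ξ))
  · refine Tendsto.const_mul _ ?_
    simp only [hchar]
    exact (Complex.tendsto_one_add_div_pow_exp (charFun ρ ξ - l)).comp
      (tendsto_atTop_mono (fun n => by simp only [N, id]; omega) tendsto_id)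

end LogLipTransform

end Transform

/-! ### Gamma-type and Gaussian integrals -/

section SpecialIntegrals

open Set in
/-- The Cauchy–Schlömilch substitution `√u - r / (2√u) = y`. -/
lemma integral_rpow_neg_half_mul_exp_of_pos {r : ℝ} (hr : 0 < r) :
    ∫ u in Ioi (0 : ℝ), u ^ (-(1 / 2) : ℝ) * Real.exp (-u - r ^ 2 / (4 * u))
      = √Real.pi * Real.exp (-r) := by
  set q : ℝ → ℝ := fun y => √(y ^ 2 + 2 * r) with hq
  have hq2 (y : ℝ) : q y ^ 2 = y ^ 2 + 2 * r := Real.sq_sqrt (by positivity)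
  have hqpos (y : ℝ) : 0 < q y := Real.sqrt_pos.2 (by positivity)
  have hqabs (y : ℝ) : |y| < q y := by
    refine abs_lt_of_sq_lt_sq ?_ (hqpos y).le
    rw [hq2]; linarith
  -- `φ y` is `√u`, the positive root of `φ² - y φ - r / 2 = 0`
  set φ : ℝ → ℝ := fun y => (y + q y) / 2 with hφ
  have hφpos (y : ℝ) : 0 < φ y := by
    have := (abs_lt.1 (hqabs y)).1
    simp only [hφ]; linarith
  have hφq (y : ℝ) : φ y ^ 2 = y * φ y + r / 2 := by
    have := hq2 y
    simp only [hφ]; nlinarith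
  have hinv (y : ℝ) : φ y - r / (2 * φ y) = y := by
    have := hφpos y
    have := hφq y
    field_simp
    linarith
  have hderiv (y : ℝ) : HasDerivAt (fun y => φ y ^ 2) (φ y * (1 + y / q y)) y := by
    have h1 : HasDerivAt q ((2 * y) / (2 * q y)) y := by
      have : HasDerivAt (fun y : ℝ => y ^ 2 + 2 * r) (2 * y) y := by
        simpa using (hasDerivAt_pow 2 y).add_const (2 * r)
      exact this.sqrt (by positivity)
    have h2 := (((hasDerivAt_id y).add h1).div_const 2).pow 2
    refine h2.congr_deriv ?_
    simp only [Pi.add_apply, id, hφ]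
    have := (hqpos y).ne'
    field_simp
    simp
    left
    ring
  have hinj : InjOn (fun y => φ y ^ 2) univ := by
    intro x _ y _ hxy
    have h : φ x = φ y := (pow_left_inj₀ (hφpos x).le (hφpos y).le two_ne_zero).1 hxy
    rw [← hinv x, ← hinv y, h]
  have himage : (fun y => φ y ^ 2) '' univ = Ioi 0 := by
    ext u
    simp only [image_univ, mem_range, mem_Ioi]
    constructor
    · rintro ⟨y, rfl⟩; exact pow_pos (hφpos y) 2
    · intro hu
      have hs : 0 < √u := Real.sqrt_pos.2 hu
      refine ⟨√u - r / (2 * √u), ?_⟩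
      have : q (√u - r / (2 * √u)) = √u + r / (2 * √u) := by
        rw [hq]
        simp only
        rw [show (√u - r / (2 * √u)) ^ 2 + 2 * r = (√u + r / (2 * √u)) ^ 2 by
          field_simp; ring]
        exact Real.sqrt_sq (by positivity)
      simp only [hφ, this]
      rw [show (√u - r / (2 * √u) + (√u + r / (2 * √u))) / 2 = √u by ring, Real.sq_sqrt hu.le]
  rw [← himage, integral_image_eq_integral_abs_deriv_smul MeasurableSet.univ
    (fun y _ => (hderiv y).hasDerivWithinAt) hinj, Measure.restrict_univ]
  have hg : Integrable fun y : ℝ => Real.exp (-y ^ 2) := by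
    simpa using integrable_exp_neg_mul_sq (b := 1) one_pos
  have hqc : Continuous q := by fun_prop
  have hodd_int : Integrable fun y : ℝ => y / q y * Real.exp (-y ^ 2) := by
    refine hg.bdd_mul (c := 1) ?_ (ae_of_all _ fun y => ?_)
    · exact (continuous_id.div hqc fun y => (hqpos y).ne').aestronglyMeasurable
    · rw [Real.norm_eq_abs, abs_div, abs_of_pos (hqpos y), div_le_one (hqpos y)]
      exact (hqabs y).le
  have hodd : ∫ y : ℝ, y / q y * Real.exp (-y ^ 2) = 0 := by
    have h := integral_neg_eq_self (fun y : ℝ => y / q y * Real.exp (-y ^ 2)) volume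
    have h' : (fun y : ℝ => -y / q (-y) * Real.exp (-(-y) ^ 2))
        = fun y => -(y / q y * Real.exp (-y ^ 2)) := by
      funext y
      simp only [hq, neg_sq]; ring
    rw [h', integral_neg] at h
    linarith
  have hint (y : ℝ) : |φ y * (1 + y / q y)| •
      ((φ y ^ 2) ^ (-(1 / 2) : ℝ) * Real.exp (-φ y ^ 2 - r ^ 2 / (4 * φ y ^ 2)))
      = Real.exp (-r) * (Real.exp (-y ^ 2) + y / q y * Real.exp (-y ^ 2)) := by
    have h0 := hφpos y
    have h1 : 0 ≤ 1 + y / q y := by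
      have : -1 ≤ y / q y := by
        rw [le_div_iff₀ (hqpos y)]
        have := (abs_lt.1 (hqabs y)).1
        linarith
      linarith
    rw [abs_of_nonneg (by positivity), smul_eq_mul, ← Real.rpow_natCast_mul h0.le,
      show -φ y ^ 2 - r ^ 2 / (4 * φ y ^ 2) = -r + -y ^ 2 by
        conv_rhs => rw [← hinv y]
        field_simp
        ring, Real.exp_add]
    norm_num
    rw [Real.rpow_neg_one]
    field_simp
  simp only [hint]
  rw [integral_const_mul, integral_add hg hodd_int, hodd, add_zero]
  have := integral_gaussian 1
  simp only [neg_mul, one_mul, div_one] at this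
  rw [this, mul_comm]

lemma integral_rpow_neg_half_mul_exp {r : ℝ} (hr : 0 ≤ r) :
    ∫ u in Set.Ioi (0 : ℝ), u ^ (-(1 / 2) : ℝ) * Real.exp (-u - r ^ 2 / (4 * u))
      = √Real.pi * Real.exp (-r) := by
  rcases hr.eq_or_lt with rfl | hr
  · have := Real.integral_rpow_mul_exp_neg_mul_Ioi (a := 1 / 2) (r := 1) (by norm_num) one_pos
    rw [Real.Gamma_one_half_eq] at this
    norm_num at this ⊢
    exact this
  · exact integral_rpow_neg_half_mul_exp_of_pos hr

lemma integral_rpow_mul_exp_neg_div {q r : ℝ} (hq : 0 < q) (hr : 0 < r) :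
    ∫ u in Set.Ioi (0 : ℝ), u ^ (-q - 1) * Real.exp (-(r / u)) = (1 / r) ^ q * Real.Gamma q := by
  rw [← Real.integral_rpow_mul_exp_neg_mul_Ioi hq hr,
    ← integral_comp_rpow_Ioi _ (p := -1) (by norm_num)]
  refine setIntegral_congr_fun measurableSet_Ioi fun u hu => ?_
  have hu : 0 < u := hu
  simp only [smul_eq_mul]
  rw [← Real.rpow_mul hu.le, Real.rpow_neg_one, div_eq_mul_inv, abs_neg, abs_one, one_mul,
    ← mul_assoc, ← Real.rpow_add hu]
  congr 2
  · ring
  · rw [inv_inv]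

lemma integrableOn_rpow_mul_exp_neg_div {q r : ℝ} (hq : 0 < q) (hr : 0 < r) :
    IntegrableOn (fun u => u ^ (-q - 1) * Real.exp (-(r / u))) (Set.Ioi 0) := by
  refine Integrable.of_integral_ne_zero ?_
  rw [integral_rpow_mul_exp_neg_div hq hr]
  have := Real.Gamma_pos_of_pos hq
  positivity

lemma one_sub_exp_neg_mul_div_bound {τ l u : ℝ} (hl : 0 ≤ l) (hu : 0 < u) :
    ‖u⁻¹ * Real.exp (-(τ * u)) * (1 - Real.exp (-(u * l)))‖ ≤ l * Real.exp (-(τ * u)) := by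
  have h1 : 0 ≤ 1 - Real.exp (-(u * l)) := by
    rw [sub_nonneg, Real.exp_le_one_iff]; nlinarith
  have h2 : 1 - Real.exp (-(u * l)) ≤ u * l := by
    have := Real.one_sub_le_exp_neg (u * l); linarith
  rw [Real.norm_eq_abs, abs_of_nonneg (by positivity)]
  calc u⁻¹ * Real.exp (-(τ * u)) * (1 - Real.exp (-(u * l)))
      ≤ u⁻¹ * Real.exp (-(τ * u)) * (u * l) := by gcongr
    _ = l * Real.exp (-(τ * u)) := by field_simp

lemma integrableOn_one_sub_exp_neg_mul_div {τ l : ℝ} (hτ : 0 < τ) (hl : 0 ≤ l) :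
    IntegrableOn (fun u => u⁻¹ * Real.exp (-(τ * u)) * (1 - Real.exp (-(u * l)))) (Set.Ioi 0) := by
  refine Integrable.mono' (g := fun u => l * Real.exp (-(τ * u))) ?_ ?_ ?_
  · have := (integrableOn_exp_mul_Ioi (a := -τ) (by linarith) 0).const_mul l
    simpa only [neg_mul] using this
  · exact Measurable.aestronglyMeasurable (by fun_prop)
  · exact (ae_restrict_iff' measurableSet_Ioi).2 <| ae_of_all _ fun u hu =>
      one_sub_exp_neg_mul_div_bound hl hu

/-- Frullani's integral for `exp`. -/
lemma integral_one_sub_exp_neg_mul_div {τ l : ℝ} (hτ : 0 < τ) (hl : 0 ≤ l) :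
    ∫ u in Set.Ioi (0 : ℝ), u⁻¹ * Real.exp (-(τ * u)) * (1 - Real.exp (-(u * l)))
      = Real.log (1 + l / τ) := by
  have key (u : ℝ) : u⁻¹ * Real.exp (-(τ * u)) * (1 - Real.exp (-(u * l)))
      = u⁻¹ • (Real.exp (-(τ * u)) - Real.exp (-((τ + l) * u))) := by
    rw [smul_eq_mul, show -((τ + l) * u) = -(τ * u) + -(u * l) by ring, Real.exp_add]; ring
  have hint := integrableOn_one_sub_exp_neg_mul_div hτ hl
  simp only [key] at hint ⊢
  have hc : Continuous fun x : ℝ => Real.exp (-x) := by fun_prop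
  rw [Frullani.integral_Ioi_eq (f := fun x => Real.exp (-x)) (L := 1) (R := 0) ?_ hτ
    (by linarith) ?_ ?_ hint]
  · rw [sub_zero, smul_eq_mul, mul_one, add_div, div_self hτ.ne']
  · exact hc.locallyIntegrable.locallyIntegrableOn _
  · simpa using hc.continuousWithinAt (s := Set.Ioi (0 : ℝ)) (x := 0) |>.tendsto
  · exact Real.tendsto_exp_comp_nhds_zero.2 tendsto_neg_atTop_atBot

end SpecialIntegrals

section Gaussian

variable {V : Type*} [NormedAddCommGroup V] [InnerProductSpace ℝ V] [FiniteDimensional ℝ V]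
  [MeasurableSpace V] [BorelSpace V]

lemma integral_cexp_neg_I_mul_gaussian {b : ℝ} (hb : 0 < b) (w : V) :
    ∫ ξ : V, Complex.exp (-(Complex.I * (⟪w, ξ⟫ : ℝ))) * (Real.exp (-(b * ‖ξ‖ ^ 2)) : ℝ)
      = (((Real.pi / b) ^ ((Module.finrank ℝ V : ℝ) / 2) * Real.exp (-(‖w‖ ^ 2 / (4 * b))) : ℝ)
        : ℂ) := by
  have h := GaussianFourier.integral_cexp_neg_mul_sq_norm_add (V := V) (b := (b : ℂ))
    (by simpa using hb) (-Complex.I) w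
  push_cast
  rw [Complex.ofReal_cpow (by positivity)]
  push_cast
  refine Eq.trans (integral_congr_ae (ae_of_all _ fun ξ => ?_)) (h.trans ?_)
  · simp only
    rw [← Complex.exp_add]
    congr 1; ring
  · congr 2
    rw [neg_sq, Complex.I_sq]; ring

lemma integral_cos_mul_gaussian {b : ℝ} (hb : 0 < b) (w : V) :
    ∫ ξ : V, Real.cos ⟪w, ξ⟫ * Real.exp (-(b * ‖ξ‖ ^ 2))
      = (Real.pi / b) ^ ((Module.finrank ℝ V : ℝ) / 2) * Real.exp (-(‖w‖ ^ 2 / (4 * b))) := by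
  have hi : Integrable fun ξ : V => ((Real.exp (-(b * ‖ξ‖ ^ 2)) : ℝ) : ℂ) := by
    have := GaussianFourier.integrable_cexp_neg_mul_sq_norm_add (V := V) (b := (b : ℂ))
      (by simpa using hb) 0 0
    simpa using this
  have h := congrArg Complex.re (integral_cexp_neg_I_mul_gaussian hb w)
  rw [Complex.ofReal_re] at h
  have h2 := integral_re (integrable_cexp_mul hi w)
  simp only [RCLike.re_to_complex] at h2
  rw [← h, ← h2]
  refine integral_congr_ae (ae_of_all _ fun ξ => ?_)
  simp only [Complex.re_mul_ofReal]
  congr 1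
  rw [show -(Complex.I * ((⟪w, ξ⟫ : ℝ) : ℂ)) = ((-⟪w, ξ⟫ : ℝ) : ℂ) * Complex.I by push_cast; ring,
    Complex.exp_ofReal_mul_I_re, Real.cos_neg]

lemma integrable_exp_neg_mul_norm_sq {b : ℝ} (hb : 0 < b) :
    Integrable fun ξ : V => Real.exp (-(b * ‖ξ‖ ^ 2)) := by
  have := GaussianFourier.integrable_cexp_neg_mul_sq_norm_add (V := V) (b := (b : ℂ))
    (by simpa using hb) 0 0
  have := this.re
  simp only [RCLike.re_to_complex] at this
  refine this.congr (ae_of_all _ fun ξ => ?_)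
  simp only [zero_mul, add_zero]
  rw [show -(b : ℂ) * (‖ξ‖ : ℂ) ^ 2 = ((-(b * ‖ξ‖ ^ 2) : ℝ) : ℂ) by push_cast; ring,
    Complex.exp_ofReal_re]

lemma integrable_one_sub_cos_mul_gaussian {b : ℝ} (hb : 0 < b) (w : V) :
    Integrable fun ξ : V => (1 - Real.cos ⟪w, ξ⟫) * Real.exp (-(b * ‖ξ‖ ^ 2)) := by
  refine (integrable_exp_neg_mul_norm_sq hb).bdd_mul (c := 2)
    (Continuous.aestronglyMeasurable (by fun_prop)) (ae_of_all _ fun ξ => ?_)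
  rw [Real.norm_eq_abs, abs_le]
  constructor <;> linarith [Real.cos_le_one ⟪w, ξ⟫, Real.neg_one_le_cos ⟪w, ξ⟫]

lemma integral_one_sub_cos_mul_gaussian {b : ℝ} (hb : 0 < b) (w : V) :
    ∫ ξ : V, (1 - Real.cos ⟪w, ξ⟫) * Real.exp (-(b * ‖ξ‖ ^ 2))
      = (Real.pi / b) ^ ((Module.finrank ℝ V : ℝ) / 2)
        * (1 - Real.exp (-(‖w‖ ^ 2 / (4 * b)))) := by
  have hi := integrable_exp_neg_mul_norm_sq (V := V) hb
  have hc : Integrable fun ξ : V => Real.cos ⟪w, ξ⟫ * Real.exp (-(b * ‖ξ‖ ^ 2)) := by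
    refine hi.bdd_mul (c := 1) (Continuous.aestronglyMeasurable (by fun_prop))
      (ae_of_all _ fun ξ => Real.abs_cos_le_one _)
  have h0 := integral_cos_mul_gaussian hb (0 : V)
  simp only [inner_zero_left, Real.cos_zero, one_mul, norm_zero] at h0
  simp only [sub_mul, one_mul]
  rw [integral_sub hi hc, integral_cos_mul_gaussian hb w, h0]
  norm_num
  ring

end Gaussian

/-! ### The variance-gamma law -/

section VarianceGamma

variable {V : Type*} [NormedAddCommGroup V] [InnerProductSpace ℝ V] [FiniteDimensional ℝ V]
  [MeasurableSpace V] [BorelSpace V]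

lemma integrable_one_add_norm_sq_div_rpow {τ : ℝ} (hτ : 0 < τ) :
    Integrable fun ξ : V => (1 + ‖ξ‖ ^ 2 / τ) ^ (-((Module.finrank ℝ V : ℝ) + 1) / 2) := by
  have h := (integrable_rpow_neg_one_add_norm_sq (E := V) (μ := volume)
    (r := (Module.finrank ℝ V : ℝ) + 1) (by linarith)).comp_smul (R := (√τ)⁻¹)
    (by have := Real.sqrt_pos.2 hτ; positivity)
  refine h.congr (ae_of_all _ fun ξ => ?_)
  simp only
  rw [norm_smul, mul_pow, norm_inv, inv_pow, Real.norm_eq_abs, sq_abs, Real.sq_sqrt hτ.le,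
    inv_mul_eq_div]

/-- The Fourier transform of `(1 + |ξ|² / τ) ^ (-(d + 1) / 2)` is a multiple of
`exp (-√τ |w|)`: the exponent is the one for which the Bessel kernel is elementary. -/
lemma invCharTransform_one_add_norm_sq_div_rpow {τ : ℝ} (hτ : 0 < τ) (w : V) :
    invCharTransform (fun ξ : V =>
        (((1 + ‖ξ‖ ^ 2 / τ) ^ (-((Module.finrank ℝ V : ℝ) + 1) / 2) : ℝ) : ℂ)) w
      = (((Real.pi * τ) ^ ((Module.finrank ℝ V : ℝ) / 2) * √Real.pi
          / Real.Gamma (((Module.finrank ℝ V : ℝ) + 1) / 2) * Real.exp (-(√τ * ‖w‖)) : ℝ) : ℂ) := by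
  set D : ℝ := (Module.finrank ℝ V : ℝ) with hD
  have hD0 : 0 ≤ D := Nat.cast_nonneg _
  set m : ℝ := (D + 1) / 2 with hm
  have hm0 : 0 < m := by positivity
  have hG : 0 < Real.Gamma m := Real.Gamma_pos_of_pos hm0
  have hpos (ξ : V) : 0 < 1 + ‖ξ‖ ^ 2 / τ := by positivity
  have hgamma (ξ : V) : ∫ u in Set.Ioi (0 : ℝ), u ^ (m - 1) * Real.exp (-((1 + ‖ξ‖ ^ 2 / τ) * u))
      = Real.Gamma m * (1 + ‖ξ‖ ^ 2 / τ) ^ (-(D + 1) / 2) := by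
    rw [Real.integral_rpow_mul_exp_neg_mul_Ioi hm0 (hpos ξ), mul_comm, one_div,
      Real.inv_rpow (hpos ξ).le, ← Real.rpow_neg (hpos ξ).le, hm, neg_div]
  have hint : Integrable (Function.uncurry fun (ξ : V) (u : ℝ) =>
      Complex.exp (-(Complex.I * (⟪w, ξ⟫ : ℝ)))
        * ((u ^ (m - 1) * Real.exp (-((1 + ‖ξ‖ ^ 2 / τ) * u)) : ℝ) : ℂ))
      (volume.prod (volume.restrict (Set.Ioi 0))) := by
    have hnorm (ξ : V) : ∫ u in Set.Ioi (0 : ℝ), ‖Complex.exp (-(Complex.I * (⟪w, ξ⟫ : ℝ)))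
        * ((u ^ (m - 1) * Real.exp (-((1 + ‖ξ‖ ^ 2 / τ) * u)) : ℝ) : ℂ)‖
        = Real.Gamma m * (1 + ‖ξ‖ ^ 2 / τ) ^ (-(D + 1) / 2) := by
      rw [← hgamma]
      refine setIntegral_congr_fun measurableSet_Ioi fun u hu => ?_
      have hu : 0 < u := hu
      rw [norm_mul, norm_cexp_neg_I_mul, one_mul, Complex.norm_real, Real.norm_of_nonneg]
      positivity
    refine (integrable_prod_iff ?_).2 ⟨ae_of_all _ fun ξ => ?_, ?_⟩
    · refine AEStronglyMeasurable.mul ?_ ?_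
      · exact Continuous.aestronglyMeasurable (by fun_prop)
      · exact (Complex.measurable_ofReal.comp (by fun_prop)).aestronglyMeasurable
    · simp only [Function.uncurry]
      have hI : IntegrableOn (fun u : ℝ => u ^ (m - 1) * Real.exp (-((1 + ‖ξ‖ ^ 2 / τ) * u)))
          (Set.Ioi 0) := by
        refine Integrable.of_integral_ne_zero ?_
        rw [hgamma]
        have := Real.rpow_pos_of_pos (hpos ξ) (-(D + 1) / 2)
        positivity
      exact hI.ofReal.const_mul _
    · simp only [Function.uncurry, hnorm]
      exact (integrable_one_add_norm_sq_div_rpow hτ).const_mul _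
  have hleft : invCharTransform (fun ξ : V => (((1 + ‖ξ‖ ^ 2 / τ) ^ (-(D + 1) / 2) : ℝ) : ℂ)) w
      = (Real.Gamma m : ℂ)⁻¹ * ∫ ξ : V, (∫ u in Set.Ioi (0 : ℝ),
        Complex.exp (-(Complex.I * (⟪w, ξ⟫ : ℝ)))
        * ((u ^ (m - 1) * Real.exp (-((1 + ‖ξ‖ ^ 2 / τ) * u)) : ℝ) : ℂ)) := by
    rw [invCharTransform, ← integral_const_mul]
    refine integral_congr_ae (ae_of_all _ fun ξ => ?_)
    simp only
    rw [integral_const_mul, integral_complex_ofReal, hgamma, Complex.ofReal_mul]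
    have : (Real.Gamma m : ℂ) ≠ 0 := by exact_mod_cast hG.ne'
    field_simp
  rw [hleft, integral_integral_swap hint]
  have hinner (u : ℝ) (hu : 0 < u) : ∫ ξ : V, Complex.exp (-(Complex.I * (⟪w, ξ⟫ : ℝ)))
        * ((u ^ (m - 1) * Real.exp (-((1 + ‖ξ‖ ^ 2 / τ) * u)) : ℝ) : ℂ)
      = (((Real.pi * τ) ^ (D / 2) * (u ^ (-(1 / 2) : ℝ)
        * Real.exp (-u - (√τ * ‖w‖) ^ 2 / (4 * u))) : ℝ) : ℂ) := by
    have e (ξ : V) : Complex.exp (-(Complex.I * (⟪w, ξ⟫ : ℝ)))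
        * ((u ^ (m - 1) * Real.exp (-((1 + ‖ξ‖ ^ 2 / τ) * u)) : ℝ) : ℂ)
        = ((u ^ (m - 1) * Real.exp (-u) : ℝ) : ℂ) * (Complex.exp (-(Complex.I * (⟪w, ξ⟫ : ℝ)))
          * (Real.exp (-(u / τ * ‖ξ‖ ^ 2)) : ℝ)) := by
      rw [show -((1 + ‖ξ‖ ^ 2 / τ) * u) = -u + -(u / τ * ‖ξ‖ ^ 2) by ring, Real.exp_add]
      push_cast
      ring
    simp only [e]
    rw [integral_const_mul, integral_cexp_neg_I_mul_gaussian (by positivity),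
      ← Complex.ofReal_mul, ← hD]
    congr 1
    rw [show Real.pi / (u / τ) = Real.pi * τ / u by field_simp,
      Real.div_rpow (by positivity) hu.le, mul_pow, Real.sq_sqrt hτ.le,
      show -u - τ * ‖w‖ ^ 2 / (4 * u) = -u + -(‖w‖ ^ 2 / (4 * (u / τ))) by field_simp; ring,
      Real.exp_add, show (-(1 / 2) : ℝ) = (m - 1) - D / 2 by rw [hm]; ring,
      Real.rpow_sub hu (m - 1) (D / 2)]
    ring
  rw [setIntegral_congr_fun measurableSet_Ioi fun u hu => hinner u hu, integral_complex_ofReal,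
    integral_const_mul, integral_rpow_neg_half_mul_exp (by positivity)]
  push_cast
  ring

lemma integrable_exp_neg_mul_norm {k : ℝ} (hk : 0 < k) :
    Integrable fun w : V => Real.exp (-(k * ‖w‖)) := by
  set n := Module.finrank ℝ V + 1 with hn
  have h := (integrable_one_add_norm (E := V) (μ := volume) (r := (n : ℝ))
    (by rw [hn]; push_cast; linarith)).const_mul (Real.exp k * (n.factorial / k ^ n))
  refine h.mono' (Continuous.aestronglyMeasurable (by fun_prop)) (ae_of_all _ fun w => ?_)
  rw [Real.norm_of_nonneg (Real.exp_pos _).le, Real.rpow_neg (by positivity), Real.rpow_natCast]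
  have h1 := Real.pow_div_factorial_le_exp (k * (1 + ‖w‖)) (by positivity) n
  rw [mul_pow, div_le_iff₀ (by positivity)] at h1
  have h2 : 0 < (1 + ‖w‖) ^ n := by positivity
  rw [show -(k * ‖w‖) = k + -(k * (1 + ‖w‖)) by ring, Real.exp_add, mul_assoc]
  refine mul_le_mul_of_nonneg_left ?_ (Real.exp_pos _).le
  rw [Real.exp_neg, ← div_eq_mul_inv, div_div, inv_eq_one_div,
    div_le_div_iff₀ (Real.exp_pos _) (by positivity)]
  linarith

lemma logLipTransform_one_add_norm_sq_div_rpow {τ : ℝ} (hτ : 0 < τ) :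
    ∃ C : ℝ≥0∞, C ≠ ⊤ ∧ LogLipTransform (√τ) C (fun ξ : V =>
      (((1 + ‖ξ‖ ^ 2 / τ) ^ (-((Module.finrank ℝ V : ℝ) + 1) / 2) : ℝ) : ℂ)) := by
  have key := invCharTransform_one_add_norm_sq_div_rpow (V := V) hτ
  set c := (Real.pi * τ) ^ ((Module.finrank ℝ V : ℝ) / 2) * √Real.pi
          / Real.Gamma (((Module.finrank ℝ V : ℝ) + 1) / 2) with hc
  have hc0 : 0 ≤ c := by
    have : 0 < Real.Gamma (((Module.finrank ℝ V : ℝ) + 1) / 2) :=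
      Real.Gamma_pos_of_pos (by positivity)
    positivity
  refine ⟨∫⁻ w : V, ENNReal.ofReal (c * Real.exp (-(√τ * ‖w‖))), ?_, ?_, ?_, ?_, ?_, ?_⟩
  · exact (((integrable_exp_neg_mul_norm (Real.sqrt_pos.2 hτ)).const_mul c).lintegral_lt_top).ne
  · exact (integrable_one_add_norm_sq_div_rpow hτ).ofReal
  · intro w; rw [key, Complex.ofReal_im]
  · intro w; rw [key, Complex.ofReal_re]; positivity
  · intro w v
    rw [key, key, Complex.ofReal_re, Complex.ofReal_re, mul_left_comm, ← Real.exp_add]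
    refine mul_le_mul_of_nonneg_left (Real.exp_le_exp.2 ?_) hc0
    have h1 : ‖w‖ ≤ ‖w + v‖ + ‖v‖ := by simpa using norm_sub_le (w + v) v
    nlinarith [Real.sqrt_nonneg τ]
  · simp only [key, Complex.ofReal_re, le_refl]

end VarianceGamma

section VarianceGammaDensity

variable {V : Type*} [NormedAddCommGroup V] [InnerProductSpace ℝ V]

/-- The Lévy density of Brownian motion time-changed by a gamma subordinator, scaled so that its
exponent is `-((d + 1) / 2) log (1 + |ξ|² / τ)`. -/
noncomputable def varianceGammaDensity (τ : ℝ) (z : V) : ℝ :=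
  ((Module.finrank ℝ V : ℝ) + 1) / 2 * ∫ u in Set.Ioi (0 : ℝ),
    u⁻¹ * Real.exp (-(τ * u)) * ((4 * Real.pi * u) ^ (-((Module.finrank ℝ V : ℝ) / 2))
      * Real.exp (-((4 * u)⁻¹ * ‖z‖ ^ 2)))

lemma varianceGammaDensity_nonneg (τ : ℝ) (z : V) : 0 ≤ varianceGammaDensity τ z := by
  refine mul_nonneg (by positivity) (setIntegral_nonneg measurableSet_Ioi fun u hu => ?_)
  have hu : 0 < u := hu
  positivity

lemma varianceGammaDensity_neg (τ : ℝ) (z : V) :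
    varianceGammaDensity τ (-z) = varianceGammaDensity τ z := by
  simp only [varianceGammaDensity, norm_neg]

lemma measurable_varianceGammaDensity [MeasurableSpace V] [BorelSpace V] (τ : ℝ) :
    Measurable (varianceGammaDensity τ : V → ℝ) := by
  refine Measurable.const_mul (StronglyMeasurable.measurable ?_) _
  refine StronglyMeasurable.integral_prod_right (f := fun (z : V) (u : ℝ) =>
    u⁻¹ * Real.exp (-(τ * u)) * ((4 * Real.pi * u) ^ (-((Module.finrank ℝ V : ℝ) / 2))
      * Real.exp (-((4 * u)⁻¹ * ‖z‖ ^ 2)))) ?_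
  exact Measurable.stronglyMeasurable (by fun_prop)

/-- Bounding `exp (-τ u)` by `(τ u) ^ (-a)` turns the mixture of Gaussians into a multiple of
`|z| ^ (-d - 2 a)`. -/
lemma exists_varianceGammaDensity_le {a : ℝ} (ha : 0 < a) (ha1 : a ≤ 1) :
    ∃ A : ℝ, 0 < A ∧ ∀ τ : ℝ, 0 < τ → ∀ z : V, z ≠ 0 →
      varianceGammaDensity τ z ≤ A * τ ^ (-a) * ‖z‖ ^ (-(Module.finrank ℝ V : ℝ) - 2 * a) := by
  set D : ℝ := (Module.finrank ℝ V : ℝ) with hD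
  have hD0 : 0 ≤ D := Nat.cast_nonneg _
  have hq : 0 < D / 2 + a := by positivity
  have hG : 0 < Real.Gamma (D / 2 + a) := Real.Gamma_pos_of_pos hq
  refine ⟨(D + 1) / 2 * (4 * Real.pi) ^ (-(D / 2)) * 4 ^ (D / 2 + a) * Real.Gamma (D / 2 + a),
    by positivity, fun τ hτ z hz => ?_⟩
  have hz : 0 < ‖z‖ := norm_pos_iff.2 hz
  have hr : 0 < ‖z‖ ^ 2 / 4 := by positivity
  have hbound (u : ℝ) (hu : 0 < u) :
      u⁻¹ * Real.exp (-(τ * u)) * ((4 * Real.pi * u) ^ (-(D / 2))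
        * Real.exp (-((4 * u)⁻¹ * ‖z‖ ^ 2)))
      ≤ (4 * Real.pi) ^ (-(D / 2)) * τ ^ (-a)
        * (u ^ (-(D / 2 + a) - 1) * Real.exp (-(‖z‖ ^ 2 / 4 / u))) := by
    -- `x ^ a ≤ max 1 x ≤ exp x`, as `0 < a ≤ 1`
    have he : Real.exp (-(τ * u)) ≤ (τ * u) ^ (-a) := by
      have hx : 0 < τ * u := by positivity
      rw [Real.exp_neg, Real.rpow_neg hx.le]
      refine inv_anti₀ (by positivity) ?_
      rcases le_total (τ * u) 1 with h | h
      · exact (Real.rpow_le_one hx.le h ha.le).trans (Real.one_le_exp hx.le)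
      · refine (Real.rpow_le_rpow_of_exponent_le h ha1).trans ?_
        rw [Real.rpow_one]; linarith [Real.add_one_le_exp (τ * u)]
    calc u⁻¹ * Real.exp (-(τ * u)) * ((4 * Real.pi * u) ^ (-(D / 2))
          * Real.exp (-((4 * u)⁻¹ * ‖z‖ ^ 2)))
        ≤ u⁻¹ * (τ * u) ^ (-a) * ((4 * Real.pi * u) ^ (-(D / 2))
          * Real.exp (-((4 * u)⁻¹ * ‖z‖ ^ 2))) := by gcongr
      _ = _ := by
        rw [Real.mul_rpow hτ.le hu.le, Real.mul_rpow (by positivity) hu.le,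
          show -(D / 2 + a) - 1 = -1 + -a + -(D / 2) by ring, Real.rpow_add hu, Real.rpow_add hu,
          Real.rpow_neg_one, show (4 * u)⁻¹ * ‖z‖ ^ 2 = ‖z‖ ^ 2 / 4 / u by field_simp]
        ring
  have hmono : ∫ u in Set.Ioi (0 : ℝ), u⁻¹ * Real.exp (-(τ * u)) * ((4 * Real.pi * u) ^ (-(D / 2))
        * Real.exp (-((4 * u)⁻¹ * ‖z‖ ^ 2)))
      ≤ (4 * Real.pi) ^ (-(D / 2)) * τ ^ (-a)
        * ((1 / (‖z‖ ^ 2 / 4)) ^ (D / 2 + a) * Real.Gamma (D / 2 + a)) := by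
    rw [← integral_rpow_mul_exp_neg_div hq hr, ← integral_const_mul]
    refine integral_mono_of_nonneg ?_ ((integrableOn_rpow_mul_exp_neg_div hq hr).const_mul _) ?_
    · exact (ae_restrict_iff' measurableSet_Ioi).2 <| ae_of_all _ fun u (hu : 0 < u) => by
        simp only [Pi.zero_apply]; positivity
    · exact (ae_restrict_iff' measurableSet_Ioi).2 <| ae_of_all _ hbound
  refine (mul_le_mul_of_nonneg_left hmono (by positivity)).trans_eq ?_
  rw [one_div_div, Real.div_rpow (by positivity) (by positivity), ← Real.rpow_natCast ‖z‖ 2,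
    ← Real.rpow_mul hz.le, show -D - 2 * a = -(((2 : ℕ) : ℝ) * (D / 2 + a)) by push_cast; ring,
    Real.rpow_neg hz.le]
  ring

lemma integral_one_sub_cos_mul_varianceGammaDensity [FiniteDimensional ℝ V] [MeasurableSpace V]
    [BorelSpace V] {τ : ℝ} (hτ : 0 < τ) (ξ : V) :
    ∫ z : V, (1 - Real.cos ⟪ξ, z⟫) * varianceGammaDensity τ z
      = ((Module.finrank ℝ V : ℝ) + 1) / 2 * Real.log (1 + ‖ξ‖ ^ 2 / τ) := by
  set D : ℝ := (Module.finrank ℝ V : ℝ) with hD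
  have hinner (u : ℝ) (hu : 0 < u) : ∫ z : V, (1 - Real.cos ⟪ξ, z⟫) *
      (u⁻¹ * Real.exp (-(τ * u)) * ((4 * Real.pi * u) ^ (-(D / 2))
        * Real.exp (-((4 * u)⁻¹ * ‖z‖ ^ 2))))
      = u⁻¹ * Real.exp (-(τ * u)) * (1 - Real.exp (-(u * ‖ξ‖ ^ 2))) := by
    have e (z : V) : (1 - Real.cos ⟪ξ, z⟫) *
      (u⁻¹ * Real.exp (-(τ * u)) * ((4 * Real.pi * u) ^ (-(D / 2))
        * Real.exp (-((4 * u)⁻¹ * ‖z‖ ^ 2))))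
      = (u⁻¹ * Real.exp (-(τ * u)) * (4 * Real.pi * u) ^ (-(D / 2))) *
        ((1 - Real.cos ⟪ξ, z⟫) * Real.exp (-((4 * u)⁻¹ * ‖z‖ ^ 2))) := by ring
    simp only [e]
    have hp : 0 < 4 * Real.pi * u := by positivity
    rw [integral_const_mul, integral_one_sub_cos_mul_gaussian (by positivity), ← hD,
      show Real.pi / (4 * u)⁻¹ = 4 * Real.pi * u by field_simp, Real.rpow_neg hp.le,
      show ‖ξ‖ ^ 2 / (4 * (4 * u)⁻¹) = u * ‖ξ‖ ^ 2 by field_simp]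
    have := (Real.rpow_pos_of_pos hp (D / 2)).ne'
    field_simp
  have hint : Integrable (Function.uncurry fun (z : V) (u : ℝ) => (1 - Real.cos ⟪ξ, z⟫) *
      (u⁻¹ * Real.exp (-(τ * u)) * ((4 * Real.pi * u) ^ (-(D / 2))
        * Real.exp (-((4 * u)⁻¹ * ‖z‖ ^ 2))))) (volume.prod (volume.restrict (Set.Ioi 0))) := by
    refine (integrable_prod_iff' ?_).2 ⟨?_, ?_⟩
    · exact Measurable.aestronglyMeasurable (by fun_prop)
    · refine (ae_restrict_iff' measurableSet_Ioi).2 <| ae_of_all _ fun u (hu : 0 < u) => ?_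
      have := (integrable_one_sub_cos_mul_gaussian (b := (4 * u)⁻¹) (by positivity) ξ).const_mul
        (u⁻¹ * Real.exp (-(τ * u)) * (4 * Real.pi * u) ^ (-(D / 2)))
      refine this.congr (ae_of_all _ fun z => ?_)
      simp only [Function.uncurry]; ring
    · refine (integrableOn_one_sub_exp_neg_mul_div hτ (sq_nonneg ‖ξ‖)).congr ?_
      refine (ae_restrict_iff' measurableSet_Ioi).2 <| ae_of_all _ fun u (hu : 0 < u) => ?_
      simp only [Function.uncurry]
      rw [← hinner u hu]
      refine integral_congr_ae (ae_of_all _ fun z => ?_)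
      have : 0 ≤ 1 - Real.cos ⟪ξ, z⟫ := sub_nonneg.2 (Real.cos_le_one _)
      simp only
      rw [Real.norm_of_nonneg (by positivity)]
  calc ∫ z : V, (1 - Real.cos ⟪ξ, z⟫) * varianceGammaDensity τ z
      = (D + 1) / 2 * ∫ z : V, (∫ u in Set.Ioi (0 : ℝ), (1 - Real.cos ⟪ξ, z⟫) *
      (u⁻¹ * Real.exp (-(τ * u)) * ((4 * Real.pi * u) ^ (-(D / 2))
        * Real.exp (-((4 * u)⁻¹ * ‖z‖ ^ 2))))) := by
        rw [← integral_const_mul]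
        refine integral_congr_ae (ae_of_all _ fun z => ?_)
        simp only [varianceGammaDensity]
        rw [integral_const_mul]
        ring
    _ = (D + 1) / 2 * ∫ u in Set.Ioi (0 : ℝ),
        u⁻¹ * Real.exp (-(τ * u)) * (1 - Real.exp (-(u * ‖ξ‖ ^ 2))) := by
        rw [integral_integral_swap hint]
        congr 1
        exact setIntegral_congr_fun measurableSet_Ioi fun u hu => hinner u hu
    _ = _ := by rw [integral_one_sub_exp_neg_mul_div hτ (sq_nonneg _)]

end VarianceGammaDensity

/-! ### The exponent of the stable process -/

lemma one_sub_cos_inner_le {V : Type*} [NormedAddCommGroup V] [InnerProductSpace ℝ V]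
    (ξ z : V) :
    1 - Real.cos ⟪ξ, z⟫ ≤ (2 + ‖ξ‖ ^ 2) * min 1 (‖z‖ ^ 2) := by
  have h1 := Real.neg_one_le_cos ⟪ξ, z⟫
  have h2 := Real.one_sub_sq_div_two_le_cos (x := ⟪ξ, z⟫)
  have h3 : ⟪ξ, z⟫ ^ 2 ≤ ‖ξ‖ ^ 2 * ‖z‖ ^ 2 := by
    rw [← mul_pow]; exact sq_le_sq' (by linarith [neg_le_of_abs_le (abs_real_inner_le_norm ξ z)])
      (real_inner_le_norm ξ z)
  have h4 := sq_nonneg ‖ξ‖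
  have h5 := sq_nonneg ‖z‖
  rcases le_total 1 (‖z‖ ^ 2) with h | h
  · rw [min_eq_left h]; linarith
  · rw [min_eq_right h]; nlinarith

section StableExponent

variable {V : Type*} [NormedAddCommGroup V] [InnerProductSpace ℝ V] [FiniteDimensional ℝ V]
  [MeasurableSpace V] [BorelSpace V]

lemma integrable_min_one_mul_norm_rpow [Nontrivial V] {α : ℝ} (hα : α ∈ Set.Ioo (0 : ℝ) 2) :
    Integrable fun z : V => min 1 (‖z‖ ^ 2) * ‖z‖ ^ (-(Module.finrank ℝ V : ℝ) - α) := by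
  obtain ⟨hα0, hα2⟩ := hα
  have hD : 0 < Module.finrank ℝ V := Module.finrank_pos
  rw [integrable_fun_norm_addHaar volume
    (f := fun y : ℝ => min 1 (y ^ 2) * y ^ (-(Module.finrank ℝ V : ℝ) - α))]
  have key (y : ℝ) (hy : y ∈ Set.Ioi (0 : ℝ)) : y ^ (Module.finrank ℝ V - 1) •
      (min 1 (y ^ 2) * y ^ (-(Module.finrank ℝ V : ℝ) - α)) = min 1 (y ^ 2) * y ^ (-1 - α) := by
    rw [smul_eq_mul, ← Real.rpow_natCast, mul_left_comm, ← Real.rpow_add (Set.mem_Ioi.1 hy),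
      Nat.cast_sub (Nat.one_le_of_lt hD)]
    congr 2; push_cast; ring
  rw [integrableOn_congr_fun key measurableSet_Ioi,
    ← Set.Ioc_union_Ioi_eq_Ioi zero_le_one]
  refine IntegrableOn.union ?_ ?_
  · have h := (intervalIntegral.intervalIntegrable_rpow' (a := 0) (b := 1) (r := 1 - α)
      (by linarith)).1
    refine h.mono' (Measurable.aestronglyMeasurable (by fun_prop)) ?_
    refine (ae_restrict_iff' measurableSet_Ioc).2 <| ae_of_all _ fun y hy => ?_
    have hy0 : 0 < y := hy.1
    rw [Real.norm_of_nonneg (by positivity)]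
    calc min 1 (y ^ 2) * y ^ (-1 - α) ≤ y ^ 2 * y ^ (-1 - α) := by
          gcongr; exact min_le_right _ _
      _ = y ^ (1 - α) := by
          rw [← Real.rpow_natCast, ← Real.rpow_add hy0]; congr 1; push_cast; ring
  · have h := integrableOn_Ioi_rpow_of_lt (a := -1 - α) (by linarith) (c := 1) one_pos
    refine h.mono' (Measurable.aestronglyMeasurable (by fun_prop)) ?_
    refine (ae_restrict_iff' measurableSet_Ioi).2 <| ae_of_all _ fun y (hy : 1 < y) => ?_
    have hy0 : 0 < y := by linarith
    rw [Real.norm_of_nonneg (by positivity)]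
    exact mul_le_of_le_one_left (by positivity) (min_le_left _ _)

/-- The integral of a function is that of its even part. -/
lemma integral_eq_integral_of_add_neg_eq {F : Type*} [NormedAddCommGroup F] [NormedSpace ℝ F]
    {G H : V → F} (hG : Integrable G) (h : ∀ z, G z + G (-z) = (2 : ℝ) • H z) :
    ∫ z, G z = ∫ z, H z := by
  have h1 : ∫ z, G (-z) = ∫ z, G z := integral_neg_eq_self G volume
  have h2 := integral_add hG hG.comp_neg
  simp only [h] at h2
  rw [h1, integral_smul, ← two_smul ℝ] at h2
  exact (smul_right_injective F (two_ne_zero (α := ℝ)) h2).symm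


lemma integrable_one_sub_cos_mul_norm_rpow [Nontrivial V] {α : ℝ} (hα : α ∈ Set.Ioo (0 : ℝ) 2)
    (ξ : V) :
    Integrable fun z : V =>
      (1 - Real.cos ⟪ξ, z⟫) * ‖z‖ ^ (-(Module.finrank ℝ V : ℝ) - α) := by
  refine ((integrable_min_one_mul_norm_rpow hα).const_mul (2 + ‖ξ‖ ^ 2)).mono'
    (Measurable.aestronglyMeasurable (by fun_prop)) (ae_of_all _ fun z => ?_)
  have h := one_sub_cos_inner_le ξ z
  have h' : 0 ≤ 1 - Real.cos ⟪ξ, z⟫ := sub_nonneg.2 (Real.cos_le_one _)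
  rw [Real.norm_of_nonneg (by positivity), ← mul_assoc]
  gcongr

lemma cexp_I_mul_add_cexp_I_mul_neg (x : ℝ) :
    Complex.exp (Complex.I * (x : ℝ)) + Complex.exp (Complex.I * ((-x : ℝ) : ℂ))
      = 2 * (Real.cos x : ℝ) := by
  rw [Complex.ofReal_cos, Complex.two_cos, mul_comm Complex.I, mul_comm Complex.I]
  push_cast
  ring_nf

/-- The exponent of a compound Poisson law with symmetric intensity `k(z) dz`. -/
lemma charFun_withDensity_sub_eq {k : V → ℝ} (hk : Integrable k) (hkm : Measurable k)
    (hk0 : ∀ z, 0 ≤ k z) (hneg : ∀ z, k (-z) = k z) (ξ : V) :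
    charFun (volume.withDensity fun z => ENNReal.ofReal (k z)) ξ
        - ((volume.withDensity fun z => ENNReal.ofReal (k z)).real Set.univ : ℝ)
      = ((-∫ z, (1 - Real.cos ⟪ξ, z⟫) * k z : ℝ) : ℂ) := by
  have := isFiniteMeasure_withDensity_ofReal hk.hasFiniteIntegral
  set ρ := volume.withDensity fun z => ENNReal.ofReal (k z) with hρ
  have hb : Integrable (fun x : V => Complex.exp ((⟪x, ξ⟫ : ℝ) * Complex.I)) ρ := by
    refine Integrable.of_bound (C := 1) (Continuous.aestronglyMeasurable (by fun_prop)) ?_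
    exact ae_of_all _ fun x => (Complex.norm_exp_ofReal_mul_I _).le
  have hone : ((ρ.real Set.univ : ℝ) : ℂ) = ∫ _, (1 : ℂ) ∂ρ := by simp
  have hb' := hb.sub (integrable_const (1 : ℂ))
  have hmeas : Measurable fun z => ENNReal.ofReal (k z) := by fun_prop
  rw [hone, charFun_apply, ← integral_sub hb (integrable_const _), hρ,
    integral_withDensity_eq_integral_toReal_smul hmeas (by simp)]
  rw [hρ, integrable_withDensity_iff_integrable_smul' hmeas (by simp)] at hb'
  simp only [Pi.sub_apply] at hb'
  rw [integral_eq_integral_of_add_neg_eq (H := fun z => ((-((1 - Real.cos ⟪ξ, z⟫) * k z) : ℝ) : ℂ))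
    hb', integral_complex_ofReal, integral_neg]
  intro z
  have h := cexp_I_mul_add_cexp_I_mul_neg ⟪ξ, z⟫
  simp only [ENNReal.toReal_ofReal (hk0 _), hneg, inner_neg_left,
    real_inner_comm ξ z, Complex.real_smul]
  rw [mul_comm (Complex.ofReal _) Complex.I, mul_comm (Complex.ofReal _) Complex.I]
  push_cast at h ⊢
  linear_combination (k z : ℂ) * h

end StableExponent

/-- The exponent of the rotationally invariant stable process, with the compensator removed by
symmetry. -/
lemma levyExponent_stableLevyMeasure {d : ℕ} (hd : 1 ≤ d) {α : ℝ} (hα : α ∈ Set.Ioo (0 : ℝ) 2)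
    (ξ : EuclideanSpace ℝ (Fin d)) :
    levyExponent (stableLevyMeasure d α) ξ
      = ((-∫ z : EuclideanSpace ℝ (Fin d), (1 - Real.cos ⟪ξ, z⟫) * ‖z‖ ^ (-(d : ℝ) - α) : ℝ)
        : ℂ) := by
  have : Nonempty (Fin d) := ⟨⟨0, hd⟩⟩
  have hmeas : Measurable fun z : EuclideanSpace ℝ (Fin d) =>
    ENNReal.ofReal (‖z‖ ^ (-(d : ℝ) - α)) := by fun_prop
  have hint := integrable_min_one_mul_norm_rpow (V := EuclideanSpace ℝ (Fin d)) hα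
  simp only [finrank_euclideanSpace_fin] at hint
  set G : EuclideanSpace ℝ (Fin d) → ℂ := fun z => Complex.exp (Complex.I * (⟪ξ, z⟫ : ℝ)) - 1
    - (if ‖z‖ ≤ 1 then Complex.I * (⟪ξ, z⟫ : ℝ) else 0) with hG
  have hGm : Measurable G := by
    refine Measurable.sub (by fun_prop) (Measurable.ite ?_ (by fun_prop) measurable_const)
    exact measurableSet_le measurable_norm measurable_const
  have hGle (z : EuclideanSpace ℝ (Fin d)) : ‖G z‖ ≤ (2 + 3 * ‖ξ‖ ^ 2) * min 1 (‖z‖ ^ 2) := by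
    have hexp : ‖Complex.exp (Complex.I * (⟪ξ, z⟫ : ℝ))‖ = 1 := by
      rw [mul_comm, Complex.norm_exp_ofReal_mul_I]
    have h2 : ‖Complex.exp (Complex.I * (⟪ξ, z⟫ : ℝ)) - 1‖ ≤ 2 := by
      refine (norm_sub_le _ _).trans ?_
      rw [hexp, norm_one]; norm_num
    have hn : ‖Complex.I * ((⟪ξ, z⟫ : ℝ) : ℂ)‖ = |⟪ξ, z⟫| := by
      rw [norm_mul, Complex.norm_I, one_mul, Complex.norm_real, Real.norm_eq_abs]
    have hx := abs_real_inner_le_norm ξ z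
    have hx2 : |⟪ξ, z⟫| ^ 2 ≤ ‖ξ‖ ^ 2 * ‖z‖ ^ 2 := by rw [← mul_pow]; gcongr
    by_cases hz : ‖z‖ ≤ 1
    · have hz2 : ‖z‖ ^ 2 ≤ 1 := pow_le_one₀ (norm_nonneg _) hz
      rw [min_eq_right hz2]
      have hG3 : ‖G z‖ ≤ 3 * |⟪ξ, z⟫| ^ 2 := by
        simp only [hG, hz, if_true]
        rcases le_total |⟪ξ, z⟫| 1 with h | h
        · refine (Complex.norm_exp_sub_one_sub_id_le (hn.trans_le h)).trans ?_
          rw [hn]; nlinarith [sq_nonneg |⟪ξ, z⟫|]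
        · refine (norm_sub_le _ _).trans ?_
          rw [hn]; nlinarith
      nlinarith [sq_nonneg ‖z‖]
    · rw [min_eq_left (by nlinarith [not_le.1 hz])]
      simp only [hG, hz, if_false, sub_zero]
      nlinarith [sq_nonneg ‖ξ‖]
  have hGi : Integrable fun z => (ENNReal.ofReal (‖z‖ ^ (-(d : ℝ) - α))).toReal • G z := by
    refine (hint.const_mul (2 + 3 * ‖ξ‖ ^ 2)).mono' ?_ (ae_of_all _ fun z => ?_)
    · exact (hmeas.ennreal_toReal.smul hGm).aestronglyMeasurable
    · rw [ENNReal.toReal_ofReal (by positivity), norm_smul, Real.norm_of_nonneg (by positivity),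
        mul_comm, ← mul_assoc]
      gcongr
      exact hGle z
  rw [levyExponent, stableLevyMeasure,
    integral_withDensity_eq_integral_toReal_smul hmeas (by simp)]
  rw [integral_eq_integral_of_add_neg_eq
    (H := fun z => ((-((1 - Real.cos ⟪ξ, z⟫) * ‖z‖ ^ (-(d : ℝ) - α)) : ℝ) : ℂ))
    hGi, integral_complex_ofReal, integral_neg]
  intro z
  have h := cexp_I_mul_add_cexp_I_mul_neg ⟪ξ, z⟫
  have hodd : G z + G (-z) = 2 * (Real.cos ⟪ξ, z⟫ : ℝ) - 2 := by
    simp only [hG, inner_neg_right, norm_neg]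
    split_ifs
    · push_cast at h ⊢
      linear_combination h
    · push_cast at h ⊢
      linear_combination h
  rw [norm_neg, ← smul_add, hodd, ENNReal.toReal_ofReal (by positivity)]
  simp only [Complex.real_smul]
  push_cast
  ring

section StableTransform

variable {V : Type*} [NormedAddCommGroup V] [InnerProductSpace ℝ V] [FiniteDimensional ℝ V]
  [MeasurableSpace V] [BorelSpace V]

/-- The Lévy measure `s |z| ^ (-d - α) dz` dominates that of a variance-gamma law whose scale is
proportional to `s ^ (1 / α)`; what is left over is a limit of finite measures. -/
lemma exists_logLipTransform_stable [Nontrivial V] {α : ℝ} (hα : α ∈ Set.Ioo (0 : ℝ) 2) :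
    ∃ A : ℝ, 0 < A ∧ ∀ s : ℝ, 0 < s → ∃ C : ℝ≥0∞, C ≠ ⊤ ∧
      LogLipTransform (A * s ^ (-(1 / α))) C (fun ξ : V => ((Real.exp (-(s *
        ∫ z : V, (1 - Real.cos ⟪ξ, z⟫) * ‖z‖ ^ (-(Module.finrank ℝ V : ℝ) - α))) : ℝ) : ℂ)) := by
  obtain ⟨hα0, hα2⟩ := id hα
  obtain ⟨A, hA, hvg⟩ := exists_varianceGammaDensity_le (V := V) (a := α / 2) (by linarith)
    (by linarith)
  refine ⟨A ^ (1 / α), by positivity, fun s hs => ?_⟩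
  -- the value of `τ` with `A τ ^ (-α / 2) = s`
  set τ : ℝ := (A / s) ^ (2 / α) with hτdef
  have hτ : 0 < τ := by positivity
  have hsqrt : √τ = A ^ (1 / α) * s ^ (-(1 / α)) := by
    rw [Real.sqrt_eq_rpow, hτdef, ← Real.rpow_mul (by positivity), Real.rpow_neg hs.le,
      show 2 / α * (1 / 2) = 1 / α by ring, Real.div_rpow hA.le hs.le, div_eq_mul_inv]
  have hAτ : A * τ ^ (-(α / 2)) = s := by
    rw [hτdef, ← Real.rpow_mul (by positivity), show 2 / α * -(α / 2) = -1 by field_simp,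
      Real.rpow_neg_one]
    field_simp
  set g : V → ℝ := fun z => ‖z‖ ^ (-(Module.finrank ℝ V : ℝ) - α) with hg
  have hg0 (z : V) : 0 ≤ g z := by positivity
  have hgm : Measurable g := by fun_prop
  have hle (z : V) (hz : z ≠ 0) : varianceGammaDensity τ z ≤ s * g z := by
    have := hvg τ hτ z hz
    rwa [hAτ, show 2 * (α / 2) = α by ring] at this
  set k : V → ℝ := fun z => s * g z - varianceGammaDensity τ z with hk
  have hkm : Measurable k := (hgm.const_mul s).sub (measurable_varianceGammaDensity τ)
  have hk0 (z : V) (hz : z ≠ 0) : 0 ≤ k z := sub_nonneg.2 (hle z hz)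
  have hkle (z : V) : k z ≤ s * g z := by
    simp only [hk]; linarith [varianceGammaDensity_nonneg τ z]
  have hcos (ξ z : V) : 0 ≤ 1 - Real.cos ⟪ξ, z⟫ := sub_nonneg.2 (Real.cos_le_one _)
  have hgi (ξ : V) : Integrable fun z => (1 - Real.cos ⟪ξ, z⟫) * (s * g z) := by
    refine ((integrable_one_sub_cos_mul_norm_rpow hα ξ).const_mul s).congr (ae_of_all _ fun z => ?_)
    simp only [hg]; ring
  have hvgi (ξ : V) : Integrable fun z => (1 - Real.cos ⟪ξ, z⟫) * varianceGammaDensity τ z := by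
    refine (hgi ξ).mono' ?_ (ae_of_all _ fun z => ?_)
    · exact (Measurable.mul (by fun_prop) (measurable_varianceGammaDensity τ)).aestronglyMeasurable
    · rw [Real.norm_of_nonneg (mul_nonneg (hcos ξ z) (varianceGammaDensity_nonneg τ z))]
      rcases eq_or_ne z 0 with rfl | hz
      · simp
      · exact mul_le_mul_of_nonneg_left (hle z hz) (hcos ξ z)
  -- the leftover Lévy density, cut off near the origin
  let ε : ℕ → ℝ := fun n => 1 / ((n : ℝ) + 1)
  have hε (n : ℕ) : 0 < ε n := by simp only [ε]; positivity
  let K : ℕ → V → ℝ := fun n => {z : V | ε n < ‖z‖}.indicator k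
  have hS (n : ℕ) : MeasurableSet {z : V | ε n < ‖z‖} :=
    measurableSet_lt measurable_const measurable_norm
  have hKm (n : ℕ) : Measurable (K n) := hkm.indicator (hS n)
  have hK0 (n : ℕ) (z : V) : 0 ≤ K n z := by
    refine Set.indicator_nonneg (fun z hz => hk0 z ?_) z
    exact norm_pos_iff.1 ((hε n).trans hz)
  have hKneg (n : ℕ) (z : V) : K n (-z) = K n z := by
    simp only [K, Set.indicator_apply, Set.mem_ofPred_eq, norm_neg, hk, hg,
      varianceGammaDensity_neg]
  have hKle (n : ℕ) (z : V) : K n z ≤ s * g z :=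
    Set.indicator_le' (fun z _ => hkle z) (fun z _ => by positivity) z
  have hKi (n : ℕ) : Integrable (K n) := by
    refine ((integrable_min_one_mul_norm_rpow (V := V) hα).const_mul
      (s * (min 1 (ε n ^ 2))⁻¹)).mono' (hKm n).aestronglyMeasurable (ae_of_all _ fun z => ?_)
    rw [Real.norm_of_nonneg (hK0 n z)]
    have hmin : 0 < min 1 (ε n ^ 2) := lt_min one_pos (pow_pos (hε n) 2)
    by_cases hz : ε n < ‖z‖
    · refine (hKle n z).trans ?_
      have h1 : min 1 (ε n ^ 2) ≤ min 1 (‖z‖ ^ 2) :=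
        min_le_min le_rfl (pow_le_pow_left₀ (hε n).le hz.le 2)
      have h2 : 1 ≤ (min 1 (ε n ^ 2))⁻¹ * min 1 (‖z‖ ^ 2) := by
        rwa [inv_mul_eq_div, one_le_div hmin]
      calc s * g z = s * 1 * g z := by ring
        _ ≤ s * ((min 1 (ε n ^ 2))⁻¹ * min 1 (‖z‖ ^ 2)) * g z := by
            have := hg0 z
            gcongr
        _ = _ := by simp only [hg]; ring
    · have : K n z = 0 := by
        simp only [K, Set.indicator_apply, Set.mem_ofPred_eq, hz, if_false]
      rw [this]; positivity
  have hfin (n : ℕ) := isFiniteMeasure_withDensity_ofReal (hKi n).hasFiniteIntegral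
  obtain ⟨C, hC, hbase⟩ := logLipTransform_one_add_norm_sq_div_rpow (V := V) hτ
  refine ⟨C, hC, ?_⟩
  rw [← hsqrt]
  have hstep (n : ℕ) := hbase.mul_exp (volume.withDensity fun z => ENNReal.ofReal (K n z))
  simp only [fun n ξ => charFun_withDensity_sub_eq (hKi n) (hKm n) (hK0 n) (hKneg n) ξ] at hstep
  refine LogLipTransform.of_tendsto hstep (integrable_one_add_norm_sq_div_rpow hτ)
    (fun n ξ => ?_) (fun ξ => ?_)
  · rw [norm_mul, Complex.norm_real, ← Complex.ofReal_exp, Complex.norm_real,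
      Real.norm_of_nonneg (by positivity), Real.norm_of_nonneg (by positivity)]
    refine mul_le_of_le_one_right (by positivity) (Real.exp_le_one_iff.2 ?_)
    rw [neg_nonpos]
    exact integral_nonneg fun z => mul_nonneg (hcos ξ z) (hK0 n z)
  · have hlim : Tendsto (fun n => ∫ z, (1 - Real.cos ⟪ξ, z⟫) * K n z) atTop
        (𝓝 (∫ z, (1 - Real.cos ⟪ξ, z⟫) * k z)) := by
      refine tendsto_integral_of_dominated_convergence _ (fun n => ?_) (hgi ξ) (fun n => ?_) ?_
      · exact (Measurable.mul (by fun_prop) (hKm n)).aestronglyMeasurable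
      · refine ae_of_all _ fun z => ?_
        rw [Real.norm_of_nonneg (mul_nonneg (hcos ξ z) (hK0 n z))]
        exact mul_le_mul_of_nonneg_left (hKle n z) (hcos ξ z)
      · refine ae_of_all _ fun z => ?_
        rcases eq_or_ne z 0 with rfl | hz
        · simp
        · have hev : ∀ᶠ n in atTop, ε n < ‖z‖ :=
            (tendsto_one_div_add_atTop_nhds_zero_nat (𝕜 := ℝ)).eventually_lt_const
              (norm_pos_iff.2 hz)
          refine tendsto_const_nhds.congr' (hev.mono fun n hn => ?_)
          simp only [K, Set.indicator_apply, Set.mem_ofPred_eq, hn, if_true]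
    have hval : ∫ z, (1 - Real.cos ⟪ξ, z⟫) * k z
        = s * (∫ z, (1 - Real.cos ⟪ξ, z⟫) * g z)
          - ((Module.finrank ℝ V : ℝ) + 1) / 2 * Real.log (1 + ‖ξ‖ ^ 2 / τ) := by
      rw [← integral_one_sub_cos_mul_varianceGammaDensity hτ, ← integral_const_mul]
      rw [← integral_sub (by simpa only [mul_left_comm] using hgi ξ) (hvgi ξ)]
      refine integral_congr_ae (ae_of_all _ fun z => ?_)
      simp only [hk]; ring
    have hpos : 0 < 1 + ‖ξ‖ ^ 2 / τ := by positivity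
    have hfinal : Real.exp (-(s * ∫ z, (1 - Real.cos ⟪ξ, z⟫) * g z))
        = (1 + ‖ξ‖ ^ 2 / τ) ^ (-((Module.finrank ℝ V : ℝ) + 1) / 2)
          * Real.exp (-∫ z, (1 - Real.cos ⟪ξ, z⟫) * k z) := by
      rw [hval, Real.rpow_def_of_pos hpos, ← Real.exp_add]
      congr 1; ring
    simp only [hg] at hfinal
    rw [hfinal, Complex.ofReal_mul]
    refine Tendsto.const_mul _ ?_
    simp only [← Complex.ofReal_exp]
    exact (Complex.continuous_ofReal.tendsto _).comp
      ((Real.continuous_exp.tendsto _).comp hlim.neg)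

end StableTransform

/-! ### Fourier inversion and the stable density -/

section Inversion

variable {V : Type*} [NormedAddCommGroup V] [InnerProductSpace ℝ V] [FiniteDimensional ℝ V]
  [MeasurableSpace V] [BorelSpace V]

open scoped FourierTransform in
/-- A law whose characteristic function has a nonnegative integrable transform has that transform,
divided by `(2π)^d`, as its density. -/
lemma LogLipTransform.eq_withDensity {κ : ℝ} {C : ℝ≥0∞} {μ : Measure V} [IsProbabilityMeasure μ]
    (h : LogLipTransform κ C (charFun μ)) (hC : C ≠ ⊤) :
    μ = volume.withDensity fun w => ENNReal.ofReal
      (((2 * Real.pi) ^ Module.finrank ℝ V)⁻¹ * (invCharTransform (charFun μ) w).re) := by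
  set c : ℝ := ((2 * Real.pi) ^ Module.finrank ℝ V)⁻¹ with hc
  have hc0 : 0 ≤ c := by positivity
  set f : V → ℝ := fun w => c * (invCharTransform (charFun μ) w).re with hf
  have hf0 (w : V) : 0 ≤ f w := mul_nonneg hc0 (h.nonneg w)
  have hfm : Measurable f := (h.continuous_re.measurable).const_mul c
  have hfi : Integrable f := by
    refine Integrable.const_mul ⟨h.continuous_re.aestronglyMeasurable, ?_⟩ c
    rw [hasFiniteIntegral_iff_ofReal (ae_of_all _ h.nonneg)]
    exact h.lintegral_le.trans_lt hC.lt_top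
  have := isFiniteMeasure_withDensity_ofReal hfi.hasFiniteIntegral
  have hpi : (2 * Real.pi) ≠ 0 := by positivity
  -- Mathlib's Fourier transform has the factor `2π` in the exponent
  set g : V → ℂ := fun v => charFun μ ((2 * Real.pi) • v) with hg
  have hgi : Integrable g := h.integrable.comp_smul hpi
  have hgc : Continuous g := continuous_charFun.comp (continuous_const_smul _)
  have hFg : 𝓕 g = fun w => ((f w : ℝ) : ℂ) := by
    funext w
    rw [Real.fourier_eq']
    have e (v : V) : Complex.exp (((-2 * Real.pi * ⟪v, w⟫ : ℝ) : ℂ) * Complex.I) • g v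
        = (fun ξ => Complex.exp (-(Complex.I * (⟪w, ξ⟫ : ℝ))) * charFun μ ξ)
          ((2 * Real.pi) • v) := by
      simp only [hg, smul_eq_mul, inner_smul_right, real_inner_comm w v]
      congr 2
      push_cast; ring
    rw [integral_congr_ae (ae_of_all _ e), Measure.integral_comp_smul_of_nonneg volume
      (fun ξ => Complex.exp (-(Complex.I * (⟪w, ξ⟫ : ℝ))) * charFun μ ξ) (2 * Real.pi)
      (hR := by positivity)]
    simp only [hf]
    rw [Complex.real_smul, Complex.ofReal_mul, h.ofReal_re, invCharTransform]
  have hinv := hgc.fourierInv_fourier_eq hgi (by rw [hFg]; exact hfi.ofReal)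
  change μ = volume.withDensity fun w => ENNReal.ofReal (f w)
  refine (Measure.ext_of_charFun (funext fun ξ => ?_)).symm
  have hξ := congrFun hinv ((2 * Real.pi)⁻¹ • ξ)
  rw [Real.fourierInv_eq', hFg] at hξ
  simp only [hg, smul_smul, mul_inv_cancel₀ hpi, one_smul] at hξ
  rw [← hξ, charFun_apply, integral_withDensity_eq_integral_toReal_smul (by fun_prop) (by simp)]
  refine integral_congr_ae (ae_of_all _ fun v => ?_)
  simp only [ENNReal.toReal_ofReal (hf0 v), inner_smul_right, Complex.real_smul, smul_eq_mul]
  rw [mul_comm, mul_inv_cancel_left₀ hpi]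

/-- Convolving a law with a law that has a bounded continuous density `p`. -/
lemma conv_withDensity_ofReal (μ : Measure V) [IsProbabilityMeasure μ] {p : V → ℝ}
    (hp : Continuous p) (hp0 : ∀ z, 0 ≤ p z) {B : ℝ} (hB : ∀ z, p z ≤ B)
    [IsFiniteMeasure (volume.withDensity fun z => ENNReal.ofReal (p z))] :
    μ.conv (volume.withDensity fun z => ENNReal.ofReal (p z))
      = volume.withDensity fun y => ENNReal.ofReal (∫ x, p (y - x) ∂μ) := by
  have hpm : Measurable fun z => ENNReal.ofReal (p z) := by fun_prop
  have hint (y : V) : Integrable (fun x => p (y - x)) μ := by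
    refine Integrable.of_bound (C := B) (Continuous.aestronglyMeasurable (by fun_prop))
      (ae_of_all _ fun x => ?_)
    rw [Real.norm_of_nonneg (hp0 _)]; exact hB _
  refine Measure.ext fun S hS => ?_
  have hSm : Measurable (S.indicator (1 : V → ℝ≥0∞)) := measurable_one.indicator hS
  rw [← lintegral_indicator_one hS, Measure.lintegral_conv hSm, withDensity_apply _ hS]
  have h1 (x : V) : ∫⁻ y, S.indicator 1 (x + y)
        ∂(volume.withDensity fun z => ENNReal.ofReal (p z))
      = ∫⁻ y in S, ENNReal.ofReal (p (y - x)) := by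
    have hSx : Measurable fun y => S.indicator (1 : V → ℝ≥0∞) (x + y) :=
      hSm.comp (measurable_const_add x)
    rw [lintegral_withDensity_eq_lintegral_mul _ hpm hSx,
      ← lintegral_indicator hS, ← lintegral_add_left_eq_self (S.indicator _) x]
    refine lintegral_congr fun y => ?_
    by_cases hy : x + y ∈ S <;> simp [Set.indicator, hy]
  simp only [h1]
  rw [lintegral_lintegral_swap]
  · refine lintegral_congr fun y => ?_
    exact (ofReal_integral_eq_lintegral_ofReal (hint y) (ae_of_all _ fun x => hp0 _)).symm
  · refine Measurable.aemeasurable ?_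
    exact hpm.comp (measurable_snd.sub measurable_fst)

end Inversion

section StableDensity

variable {d : ℕ} {α : ℝ}

/-- At time `t`, the logarithm of the stable density is Lipschitz with constant of order
`t ^ (-1 / α)`. -/
lemma exists_logLipTransform_levyExponent (hd : 1 ≤ d) (hα : α ∈ Set.Ioo (0 : ℝ) 2) :
    ∃ A : ℝ, 0 < A ∧ ∀ t : ℝ≥0, 0 < t → ∃ C : ℝ≥0∞, C ≠ ⊤ ∧
      LogLipTransform (A * (t : ℝ) ^ (-(1 / α))) C (fun ξ : EuclideanSpace ℝ (Fin d) =>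
        Complex.exp ((t : ℝ) * levyExponent (stableLevyMeasure d α) ξ)) := by
  have : Nonempty (Fin d) := ⟨⟨0, hd⟩⟩
  obtain ⟨A, hA, h⟩ := exists_logLipTransform_stable (V := EuclideanSpace ℝ (Fin d)) hα
  refine ⟨A, hA, fun t ht => ?_⟩
  obtain ⟨C, hC, h⟩ := h t ht
  refine ⟨C, hC, ?_⟩
  simp only [finrank_euclideanSpace_fin] at h
  simp only [levyExponent_stableLevyMeasure hd hα, ← Complex.ofReal_mul, ← Complex.ofReal_exp,
    mul_neg]
  exact h

lemma stableDensity_eq_invCharTransform (d : ℕ) (α : ℝ) (t : ℝ≥0)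
    (x : EuclideanSpace ℝ (Fin d)) :
    stableDensity d α t x = ((2 * Real.pi) ^ d)⁻¹ * (invCharTransform (fun ξ =>
        Complex.exp ((t : ℝ) * levyExponent (stableLevyMeasure d α) ξ)) x).re := rfl

lemma stableDensity_neg (hd : 1 ≤ d) (hα : α ∈ Set.Ioo (0 : ℝ) 2) (t : ℝ≥0)
    (x : EuclideanSpace ℝ (Fin d)) : stableDensity d α t (-x) = stableDensity d α t x := by
  simp only [stableDensity_eq_invCharTransform, invCharTransform]
  rw [← integral_neg_eq_self]
  simp only [levyExponent_stableLevyMeasure hd hα, inner_neg_left, inner_neg_right, neg_neg,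
    Real.cos_neg]

variable {Ω : Type*} [MeasurableSpace Ω] {P : Measure Ω}
  {L : ℝ≥0 → Ω → EuclideanSpace ℝ (Fin d)}

lemma IsStableProcess.isProbabilityMeasure_map [IsProbabilityMeasure P]
    (hL : IsStableProcess α L P) (t : ℝ≥0) :
    IsProbabilityMeasure (P.map (L t)) :=
  Measure.isProbabilityMeasure_map (hL.measurable t).aemeasurable

lemma IsStableProcess.charFun_map (hL : IsStableProcess α L P) (t : ℝ≥0) :
    charFun (P.map (L t))
      = fun ξ => Complex.exp ((t : ℝ) * levyExponent (stableLevyMeasure d α) ξ) :=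
  funext (hL.charFun_eq t)

lemma IsStableProcess.map_eq_withDensity [IsProbabilityMeasure P] (hd : 1 ≤ d) (hα : α ∈ Set.Ioo (0 : ℝ) 2)
    (hL : IsStableProcess α L P) {t : ℝ≥0} (ht : 0 < t) :
    P.map (L t) = volume.withDensity fun y => ENNReal.ofReal (stableDensity d α t y) := by
  obtain ⟨A, -, h⟩ := exists_logLipTransform_levyExponent hd hα
  obtain ⟨C, hC, h⟩ := h t ht
  have := hL.isProbabilityMeasure_map t
  rw [← hL.charFun_map] at h
  have := h.eq_withDensity hC
  simpa only [hL.charFun_map, finrank_euclideanSpace_fin, ← stableDensity_eq_invCharTransform]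
    using this

/-- The semigroup property of the stable densities. -/
lemma IsStableProcess.integral_stableDensity_sub [IsProbabilityMeasure P] (hd : 1 ≤ d)
    (hα : α ∈ Set.Ioo (0 : ℝ) 2)
    (hL : IsStableProcess α L P) {s : ℝ≥0} (hs : 0 < s) (t : ℝ≥0)
    (w : EuclideanSpace ℝ (Fin d)) :
    ∫ z, stableDensity d α s (w - z) ∂(P.map (L t)) = stableDensity d α (s + t) w := by
  obtain ⟨A, -, h⟩ := exists_logLipTransform_levyExponent hd hα
  obtain ⟨C, -, h⟩ := h s hs
  have := hL.isProbabilityMeasure_map t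
  have key := h.invCharTransform_mul_charFun_eq (P.map (L t)) w
  simp only [stableDensity_eq_invCharTransform]
  rw [integral_const_mul, ← Complex.ofReal_re (∫ z, _ ∂_), ← key]
  simp only [hL.charFun_eq, ← Complex.exp_add, NNReal.coe_add, Complex.ofReal_add, add_mul]

end StableDensity

/-! ### Chains with bounded drift and stable noise -/

section StableDensityBounds

variable {d : ℕ} {α : ℝ}

lemma stableDensity_nonneg (hd : 1 ≤ d) (hα : α ∈ Set.Ioo (0 : ℝ) 2) {t : ℝ≥0} (ht : 0 < t)
    (x : EuclideanSpace ℝ (Fin d)) : 0 ≤ stableDensity d α t x := by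
  obtain ⟨A, -, h⟩ := exists_logLipTransform_levyExponent hd hα
  obtain ⟨C, -, h⟩ := h t ht
  exact mul_nonneg (by positivity) (h.nonneg x)

lemma continuous_stableDensity (hd : 1 ≤ d) (hα : α ∈ Set.Ioo (0 : ℝ) 2) {t : ℝ≥0}
    (ht : 0 < t) : Continuous (stableDensity d α t) := by
  obtain ⟨A, -, h⟩ := exists_logLipTransform_levyExponent hd hα
  obtain ⟨C, -, h⟩ := h t ht
  exact continuous_const.mul h.continuous_re

lemma exists_stableDensity_le (d : ℕ) (α : ℝ) (t : ℝ≥0) :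
    ∃ B : ℝ, ∀ x, stableDensity d α t x ≤ B := by
  refine ⟨((2 * Real.pi) ^ d)⁻¹ * ∫ ξ : EuclideanSpace ℝ (Fin d),
    ‖Complex.exp ((t : ℝ) * levyExponent (stableLevyMeasure d α) ξ)‖, fun x => ?_⟩
  rw [stableDensity_eq_invCharTransform]
  gcongr
  exact (Complex.re_le_norm _).trans (norm_invCharTransform_le _ _)

lemma integrable_stableDensity_sub (hd : 1 ≤ d) (hα : α ∈ Set.Ioo (0 : ℝ) 2) {t : ℝ≥0}
    (ht : 0 < t) (μ : Measure (EuclideanSpace ℝ (Fin d))) [IsFiniteMeasure μ]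
    (y : EuclideanSpace ℝ (Fin d)) : Integrable (fun x => stableDensity d α t (y - x)) μ := by
  obtain ⟨B, hB⟩ := exists_stableDensity_le d α t
  refine Integrable.of_bound (C := B) ?_ (ae_of_all _ fun x => ?_)
  · exact ((continuous_stableDensity hd hα ht).comp (by fun_prop)).aestronglyMeasurable
  · rw [Real.norm_of_nonneg (stableDensity_nonneg hd hα ht _)]; exact hB _

lemma exists_stableDensity_add_le (hd : 1 ≤ d) (hα : α ∈ Set.Ioo (0 : ℝ) 2) :
    ∃ A : ℝ, 0 < A ∧ ∀ t : ℝ≥0, 0 < t → ∀ x v : EuclideanSpace ℝ (Fin d),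
      stableDensity d α t (x + v)
        ≤ Real.exp (A * (t : ℝ) ^ (-(1 / α)) * ‖v‖) * stableDensity d α t x := by
  obtain ⟨A, hA, h⟩ := exists_logLipTransform_levyExponent hd hα
  refine ⟨A, hA, fun t ht x v => ?_⟩
  obtain ⟨C, -, h⟩ := h t ht
  simp only [stableDensity_eq_invCharTransform]
  rw [mul_left_comm]
  exact mul_le_mul_of_nonneg_left (h.growth x v) (by positivity)

/-- The effect of one drift step on a law that is afterwards smoothed by the stable semigroup. -/
lemma integral_stableDensity_sub_map_le (hd : 1 ≤ d) (hα : α ∈ Set.Ioo (0 : ℝ) 2) {A : ℝ}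
    (hA : 0 ≤ A) (hlip : ∀ t : ℝ≥0, 0 < t → ∀ x v : EuclideanSpace ℝ (Fin d),
      stableDensity d α t (x + v)
        ≤ Real.exp (A * (t : ℝ) ^ (-(1 / α)) * ‖v‖) * stableDensity d α t x)
    {t : ℝ≥0} (ht : 0 < t) (μ : Measure (EuclideanSpace ℝ (Fin d))) [IsProbabilityMeasure μ]
    {β : EuclideanSpace ℝ (Fin d) → EuclideanSpace ℝ (Fin d)} (hβ : Measurable β) {B : ℝ}
    (hB : ∀ z, ‖β z‖ ≤ B) (y : EuclideanSpace ℝ (Fin d)) :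
    ∫ x, stableDensity d α t (y - x) ∂(μ.map fun z => z + β z)
      ≤ Real.exp (A * (t : ℝ) ^ (-(1 / α)) * B) * ∫ x, stableDensity d α t (y - x) ∂μ := by
  have hm : Measurable fun z => z + β z := measurable_id.add hβ
  have := Measure.isProbabilityMeasure_map (μ := μ) hm.aemeasurable
  have hi := integrable_stableDensity_sub hd hα ht (μ.map fun z => z + β z) y
  rw [integral_map hm.aemeasurable hi.aestronglyMeasurable, ← integral_const_mul]
  refine integral_mono (hi.comp_measurable hm)
    ((integrable_stableDensity_sub hd hα ht μ y).const_mul _) fun z => ?_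
  have h := hlip t ht (y - z) (-β z)
  rw [norm_neg, show y - z + -β z = y - (z + β z) by abel] at h
  refine h.trans (mul_le_mul_of_nonneg_right (Real.exp_le_exp.2 ?_)
    (stableDensity_nonneg hd hα ht _))
  exact mul_le_mul_of_nonneg_left (hB z) (by positivity)

lemma IsStableProcess.integral_stableDensity_sub_conv {Ω : Type*} [MeasurableSpace Ω]
    {P : Measure Ω} [IsProbabilityMeasure P] {L : ℝ≥0 → Ω → EuclideanSpace ℝ (Fin d)}
    (hd : 1 ≤ d) (hα : α ∈ Set.Ioo (0 : ℝ) 2)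
    (hL : IsStableProcess α L P) {s : ℝ≥0} (hs : 0 < s) (t : ℝ≥0)
    (μ : Measure (EuclideanSpace ℝ (Fin d))) [IsProbabilityMeasure μ]
    (y : EuclideanSpace ℝ (Fin d)) :
    ∫ x, stableDensity d α s (y - x) ∂(μ.conv (P.map (L t)))
      = ∫ x, stableDensity d α (s + t) (y - x) ∂μ := by
  have := hL.isProbabilityMeasure_map t
  rw [integral_conv (integrable_stableDensity_sub hd hα hs _ y)]
  refine integral_congr_ae (ae_of_all _ fun x => ?_)
  simp only [← sub_sub]
  exact hL.integral_stableDensity_sub hd hα hs t (y - x)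

end StableDensityBounds

/-- The telescoping bound behind `∫₀ᵗ u ^ (-1 / α) du < ∞`. -/
lemma sub_mul_rpow_neg_le {α a b : ℝ} (hα : 1 < α) (ha : 0 < a) (hb : 0 ≤ b) :
    (a - b) * a ^ (-(1 / α)) ≤ (a ^ (1 - 1 / α) - b ^ (1 - 1 / α)) / (1 - 1 / α) := by
  set γ := 1 - 1 / α with hγ
  have hα0 : 0 < α := by linarith
  have h1 : 1 / α < 1 := (div_lt_one hα0).2 hα
  have h0 : 0 < 1 / α := by positivity
  have hγ0 : 0 < γ := by linarith
  have h := rpow_one_add_le_one_add_mul_self (s := b / a - 1) (p := γ)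
    (by have : 0 ≤ b / a := by positivity
        linarith) hγ0.le (by linarith)
  rw [show 1 + (b / a - 1) = b / a by ring, Real.div_rpow hb ha.le,
    div_le_iff₀ (Real.rpow_pos_of_pos ha _)] at h
  rw [le_div_iff₀ hγ0]
  have e : a ^ (-(1 / α)) * a = a ^ γ := by
    rw [← Real.rpow_add_one ha.ne', hγ]; congr 1; ring
  have e' : (1 + γ * (b / a - 1)) * a ^ γ = a ^ γ + γ * (b - a) * a ^ (-(1 / α)) := by
    rw [← e]; field_simp
  rw [e'] at h
  linarith

section Chain

variable {d : ℕ} {α : ℝ} {Ω : Type*} [MeasurableSpace Ω] {P : Measure Ω} [IsProbabilityMeasure P]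
  {L : ℝ≥0 → Ω → EuclideanSpace ℝ (Fin d)}

/-- Along the chain of laws `μ k` at the times `τ k`, the smoothed value
`∫ p (t - τ k) (y - z) ∂(μ k)` grows by a factor at most
`exp (A K (τ (k + 1) - τ k) (t - τ k) ^ (-1 / α))` per step. The stated bound is the telescoped
product, for the law at `τ k` followed by one more drift increment. -/
lemma IsStableProcess.integral_stableDensity_chain_le (hd : 1 ≤ d) (hα : α ∈ Set.Ioo (1 : ℝ) 2)
    (hL : IsStableProcess α L P) {A : ℝ}
    (hA : 0 ≤ A) (hlip : ∀ t : ℝ≥0, 0 < t → ∀ x v : EuclideanSpace ℝ (Fin d),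
      stableDensity d α t (x + v)
        ≤ Real.exp (A * (t : ℝ) ^ (-(1 / α)) * ‖v‖) * stableDensity d α t x)
    {t : ℝ≥0} {τ : ℕ → ℝ≥0} (hτ0 : τ 0 = 0) (hτ : Monotone τ) (hτt : ∀ k, τ k ≤ t)
    {K : ℝ} (hK : 0 ≤ K)
    {β : ℕ → EuclideanSpace ℝ (Fin d) → EuclideanSpace ℝ (Fin d)} (hβ : ∀ k, Measurable (β k))
    (hβK : ∀ k z, ‖β k z‖ ≤ K * ((τ (k + 1) : ℝ) - τ k))
    {μ : ℕ → Measure (EuclideanSpace ℝ (Fin d))} (hprob : ∀ k, IsProbabilityMeasure (μ k))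
    {x : EuclideanSpace ℝ (Fin d)} (hμ0 : μ 0 = Measure.dirac x)
    (hμ : ∀ k, μ (k + 1) = ((μ k).map fun z => z + β k z).conv (P.map (L (τ (k + 1) - τ k))))
    (y : EuclideanSpace ℝ (Fin d)) (k : ℕ) (hk : τ k < t) :
    ∫ z, stableDensity d α (t - τ k) (y - z) ∂((μ k).map fun z => z + β k z)
      ≤ Real.exp (A * K * (((t : ℝ) ^ (1 - 1 / α)
          - ((t : ℝ) - τ (k + 1)) ^ (1 - 1 / α)) / (1 - 1 / α)))
        * stableDensity d α t (y - x) := by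
  have hα' : α ∈ Set.Ioo (0 : ℝ) 2 := ⟨by linarith [hα.1], hα.2⟩
  have hpos {k : ℕ} (hk : τ k < t) : 0 < t - τ k := tsub_pos_of_lt hk
  have hcoe (k : ℕ) : ((t - τ k : ℝ≥0) : ℝ) = (t : ℝ) - τ k := NNReal.coe_sub (hτt k)
  have hstep (k : ℕ) (hk : τ k < t)
      (hQ : ∫ z, stableDensity d α (t - τ k) (y - z) ∂(μ k)
        ≤ Real.exp (A * K * (((t : ℝ) ^ (1 - 1 / α)
          - ((t : ℝ) - τ k) ^ (1 - 1 / α)) / (1 - 1 / α))) * stableDensity d α t (y - x)) :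
      ∫ z, stableDensity d α (t - τ k) (y - z) ∂((μ k).map fun z => z + β k z)
      ≤ Real.exp (A * K * (((t : ℝ) ^ (1 - 1 / α)
          - ((t : ℝ) - τ (k + 1)) ^ (1 - 1 / α)) / (1 - 1 / α)))
        * stableDensity d α t (y - x) := by
    have hkt : (0 : ℝ) < (t : ℝ) - τ k := by rw [← hcoe]; exact_mod_cast hpos hk
    have hkt' : (0 : ℝ) ≤ (t : ℝ) - τ (k + 1) := by rw [← hcoe]; positivity
    refine (integral_stableDensity_sub_map_le hd hα' hA hlip (hpos hk) (μ k) (hβ k) (hβK k)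
      y).trans ?_
    refine (mul_le_mul_of_nonneg_left hQ (Real.exp_pos _).le).trans ?_
    rw [← mul_assoc, ← Real.exp_add]
    refine mul_le_mul_of_nonneg_right (Real.exp_le_exp.2 ?_)
      (stableDensity_nonneg hd hα' (hk.trans_le' zero_le) _)
    have h := mul_le_mul_of_nonneg_left (sub_mul_rpow_neg_le hα.1 hkt hkt') (mul_nonneg hA hK)
    rw [show (t : ℝ) - τ k - (t - τ (k + 1)) = τ (k + 1) - τ k by ring] at h
    rw [hcoe]
    calc _ = A * K * ((τ (k + 1) - τ k) * ((t : ℝ) - τ k) ^ (-(1 / α)))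
          + A * K * (((t : ℝ) ^ (1 - 1 / α) - ((t : ℝ) - τ k) ^ (1 - 1 / α)) / (1 - 1 / α)) := by
          ring
      _ ≤ _ := add_le_add_left h _
      _ = _ := by ring
  refine hstep k hk ?_
  induction k with
  | zero =>
    rw [hμ0, integral_dirac, hτ0]
    simp
  | succ k ih =>
    have hk' : τ k < t := (hτ k.le_succ).trans_lt hk
    have hm : Measurable fun z => z + β k z := measurable_id.add (hβ k)
    have := Measure.isProbabilityMeasure_map (μ := μ k) hm.aemeasurable
    rw [hμ k, hL.integral_stableDensity_sub_conv hd hα' (hpos hk),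
      tsub_add_tsub_cancel (hτt _) (hτ k.le_succ)]
    exact hstep k hk' (ih hk')

end Chain

section EulerChain

variable {E : Type*} [AddCommGroup E]

/-- The chain `y ↦ y + β k y + D k` started from `x`: the Euler scheme on its grid, as a function
of the drift increments `β k` and the noise increments `D k`. -/
def eulerChain (x : E) (β : ℕ → E → E) (D : ℕ → E) : ℕ → E
  | 0 => x
  | k + 1 => eulerChain x β D k + β k (eulerChain x β D k) + D k

variable [MeasurableSpace E] [MeasurableAdd₂ E]

/-- The state after `k` steps is a measurable function of the first `k` noise increments. -/
lemma exists_measurable_eulerChain_eq (x : E) {β : ℕ → E → E} (hβ : ∀ k, Measurable (β k))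
    (k : ℕ) : ∃ G : (Finset.range k → E) → E, Measurable G ∧
      ∀ D : ℕ → E, eulerChain x β D k = G fun i => D i := by
  induction k with
  | zero => exact ⟨fun _ => x, measurable_const, fun D => rfl⟩
  | succ k ih =>
    obtain ⟨G, hG, h⟩ := ih
    let r : (Finset.range (k + 1) → E) → (Finset.range k → E) :=
      fun v i => v ⟨i, Finset.mem_range.2 ((Finset.mem_range.1 i.2).trans k.lt_succ_self)⟩
    have hr : Measurable r := measurable_pi_lambda _ fun i => measurable_pi_apply _
    refine ⟨fun v => G (r v) + β k (G (r v)) + v ⟨k, Finset.self_mem_range_succ k⟩, ?_, fun D => ?_⟩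
    · exact ((hG.comp hr).add ((hβ k).comp (hG.comp hr))).add (measurable_pi_apply _)
    · simp only [eulerChain, h, r]

lemma measurable_eulerChain {Ω : Type*} [MeasurableSpace Ω] (x : E) {β : ℕ → E → E}
    (hβ : ∀ k, Measurable (β k)) {D : ℕ → Ω → E} (hD : ∀ k, Measurable (D k)) (k : ℕ) :
    Measurable fun ω => eulerChain x β (fun i => D i ω) k := by
  obtain ⟨G, hG, h⟩ := exists_measurable_eulerChain_eq x hβ k
  simp only [h]
  exact hG.comp (measurable_pi_lambda _ fun i => hD i)

lemma indepFun_eulerChain {Ω : Type*} [MeasurableSpace Ω] {P : Measure Ω} (x : E)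
    {β : ℕ → E → E} (hβ : ∀ k, Measurable (β k)) {D : ℕ → Ω → E} (hD : ∀ k, Measurable (D k))
    (hind : iIndepFun D P) (k : ℕ) :
    IndepFun (fun ω => eulerChain x β (fun i => D i ω) k) (D k) P := by
  obtain ⟨G, hG, h⟩ := exists_measurable_eulerChain_eq x hβ k
  simp only [h]
  have hdisj : Disjoint (Finset.range k) {k} := by simp
  exact (hind.indepFun_finset _ _ hdisj hD).comp hG
    (measurable_pi_apply (⟨k, Finset.mem_singleton_self k⟩ : ({k} : Finset ℕ)))

end EulerChain

/-! ### The Euler scheme -/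

section EulerScheme

lemma gridFloor_eq {T : ℝ≥0} (hT : 0 < T) {N : ℕ} (hN : 1 ≤ N) {k : ℕ} {s : ℝ≥0}
    (h1 : k * (T / N) ≤ s) (h2 : s < (k + 1) * (T / N)) :
    gridFloor T N s = k * (T / (N : ℝ≥0)) := by
  have hh : 0 < T / (N : ℝ≥0) := div_pos hT (by exact_mod_cast hN)
  have : ⌊s / (T / (N : ℝ≥0))⌋₊ = k := by
    rw [Nat.floor_eq_iff zero_le]
    exact ⟨(le_div_iff₀ hh).2 h1, (div_lt_iff₀ hh).2 h2⟩
  rw [gridFloor, this]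

variable {d : ℕ} {b : ℝ≥0 → EuclideanSpace ℝ (Fin d) → EuclideanSpace ℝ (Fin d)}

/-- The drift increment over `[s, t]` with the state frozen at `z`. -/
noncomputable def driftIncrement (b : ℝ≥0 → EuclideanSpace ℝ (Fin d) → EuclideanSpace ℝ (Fin d)) (s t : ℝ≥0)
    (z : EuclideanSpace ℝ (Fin d)) : EuclideanSpace ℝ (Fin d) :=
  ∫ u in (s : ℝ)..(t : ℝ), b u.toNNReal z

lemma measurable_driftIncrement (hb : Measurable (Function.uncurry b)) {s t : ℝ≥0} (hst : s ≤ t) :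
    Measurable (driftIncrement b s t) := by
  have h : driftIncrement b s t = fun z => ∫ u in Set.Ioc (s : ℝ) t, b u.toNNReal z :=
    funext fun z => intervalIntegral.integral_of_le (by exact_mod_cast hst)
  rw [h]
  refine StronglyMeasurable.measurable (StronglyMeasurable.integral_prod_right
    (f := fun z (u : ℝ) => b u.toNNReal z) (Measurable.stronglyMeasurable ?_))
  exact hb.comp ((measurable_real_toNNReal.comp measurable_snd).prodMk measurable_fst)

lemma norm_driftIncrement_le {K : ℝ} (hK : ∀ s x, ‖b s x‖ ≤ K) {s t : ℝ≥0} (hst : s ≤ t)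
    (z : EuclideanSpace ℝ (Fin d)) : ‖driftIncrement b s t z‖ ≤ K * ((t : ℝ) - s) := by
  have h := intervalIntegral.norm_integral_le_of_norm_le_const (a := (s : ℝ)) (b := t)
    (f := fun u : ℝ => b u.toNNReal z) (C := K) fun u _ => hK _ _
  rwa [abs_of_nonneg (sub_nonneg.2 (by exact_mod_cast hst))] at h

variable {Ω : Type*} [MeasurableSpace Ω] {P : Measure Ω} {α : ℝ}
  {L : ℝ≥0 → Ω → EuclideanSpace ℝ (Fin d)} {T : ℝ≥0} {N : ℕ} {x : EuclideanSpace ℝ (Fin d)}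
  {X : ℝ≥0 → Ω → EuclideanSpace ℝ (Fin d)}

lemma intervalIntegrable_gridFloor (hb : Measurable (Function.uncurry b)) {K : ℝ}
    (hK : ∀ s x, ‖b s x‖ ≤ K) (f : ℝ≥0 → EuclideanSpace ℝ (Fin d)) (T : ℝ≥0) (N : ℕ) (r s : ℝ) :
    IntervalIntegrable (fun u : ℝ => b u.toNNReal (f (gridFloor T N u.toNNReal))) volume r s := by
  have hm : Measurable fun u : ℝ => f (gridFloor T N u.toNNReal) := by
    have h1 : Measurable fun u : ℝ => ⌊u.toNNReal / (T / (N : ℝ≥0))⌋₊ :=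
      Nat.measurable_floor.comp (by fun_prop)
    exact (measurable_from_nat (f := fun n : ℕ => f ((n : ℝ≥0) * (T / (N : ℝ≥0))))).comp h1
  have hm' : Measurable fun u : ℝ => b u.toNNReal (f (gridFloor T N u.toNNReal)) :=
    hb.comp (measurable_real_toNNReal.prodMk hm)
  refine (intervalIntegrable_const (c := K)).mono_fun hm'.aestronglyMeasurable
    (ae_of_all _ fun u => ?_)
  exact (hK _ _).trans (le_abs_self K)

lemma IsEulerScheme.ae_eq (hX : IsEulerScheme P b L T N x X) (hL0 : ∀ᵐ ω ∂P, L 0 ω = 0)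
    {t : ℝ≥0} (ht : t ≤ T) : ∀ᵐ ω ∂P, X t ω
      = x + (∫ s in (0 : ℝ)..(t : ℝ), b s.toNNReal (X (gridFloor T N s.toNNReal) ω)) + L t ω := by
  rcases eq_zero_or_pos t with rfl | h
  · filter_upwards [hX.init, hL0] with ω h1 h2
    simp [h1, h2]
  · exact hX.eqn t h ht

/-- Between two grid points the state in the drift is frozen at the left one; the value of
`gridFloor` at the right end point does not matter for the integral. -/
lemma IsEulerScheme.ae_step (hT : 0 < T) (hN : 1 ≤ N) (hb : Measurable (Function.uncurry b))
    {K : ℝ} (hK : ∀ s x, ‖b s x‖ ≤ K) (hX : IsEulerScheme P b L T N x X)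
    (hL0 : ∀ᵐ ω ∂P, L 0 ω = 0) {k : ℕ} {r : ℝ≥0} (h1 : k * (T / N) ≤ r)
    (h2 : r ≤ (k + 1) * (T / N)) (hr : r ≤ T) :
    ∀ᵐ ω ∂P, X r ω = X (k * (T / N)) ω + driftIncrement b (k * (T / N)) r (X (k * (T / N)) ω)
      + (L r ω - L (k * (T / N)) ω) := by
  filter_upwards [hX.ae_eq hL0 hr, hX.ae_eq hL0 (h1.trans hr)] with ω e1 e2
  have hI := intervalIntegrable_gridFloor hb hK (fun s => X s ω) T N
  have hsub := intervalIntegral.integral_interval_sub_left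
    (hI 0 r) (hI 0 ((k * (T / N) : ℝ≥0) : ℝ))
  have hdrift : ∫ s in ((k * (T / N) : ℝ≥0) : ℝ)..(r : ℝ),
      b s.toNNReal (X (gridFloor T N s.toNNReal) ω)
      = driftIncrement b (k * (T / N)) r (X (k * (T / N)) ω) := by
    refine intervalIntegral.integral_congr_Ioo_of_le (by exact_mod_cast h1) fun s hs => ?_
    have hs0 : 0 ≤ s := (NNReal.coe_nonneg _).trans hs.1.le
    lift s to ℝ≥0 using hs0
    simp only [Real.toNNReal_coe]
    rw [gridFloor_eq hT hN (by exact_mod_cast hs.1.le)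
      ((show s < r by exact_mod_cast hs.2).trans_le h2)]
  rw [hdrift] at hsub
  rw [← hsub]
  nth_rewrite 1 [e1]
  nth_rewrite 1 [e2]
  abel

/-- The grid is stopped at `t`, so that all later steps of the chain are trivial. -/
lemma IsEulerScheme.ae_eq_eulerChain (hT : 0 < T) (hN : 1 ≤ N)
    (hb : Measurable (Function.uncurry b))
    {K : ℝ} (hK : ∀ s x, ‖b s x‖ ≤ K) (hX : IsEulerScheme P b L T N x X)
    (hL0 : ∀ᵐ ω ∂P, L 0 ω = 0) {t : ℝ≥0} (ht : t ≤ T) {τ : ℕ → ℝ≥0}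
    (hτ : ∀ k : ℕ, τ k = min (k * (T / N)) t) (k : ℕ) :
    ∀ᵐ ω ∂P, X (τ k) ω = eulerChain x (fun k => driftIncrement b (τ k) (τ (k + 1)))
      (fun k => L (τ (k + 1)) ω - L (τ k) ω) k := by
  induction k with
  | zero =>
    filter_upwards [hX.init] with ω h
    simpa [hτ, eulerChain] using h
  | succ k ih =>
    simp only [eulerChain]
    rcases le_total t (k * (T / N)) with h | h
    · have e1 : τ k = t := by rw [hτ, min_eq_right h]
      have e2 : τ (k + 1) = t := by
        rw [hτ, min_eq_right (h.trans (by gcongr; simp))]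
      filter_upwards [ih] with ω hω
      rw [← hω, e1, e2]
      simp [driftIncrement]
    · have e1 : τ k = k * (T / N) := by rw [hτ, min_eq_left h]
      have hk1 : (k : ℝ≥0) * (T / N) ≤ τ (k + 1) := by
        rw [hτ]; exact le_min (by gcongr; simp) h
      have hk2 : τ (k + 1) ≤ ((k : ℝ≥0) + 1) * (T / N) := by
        rw [hτ]; push_cast; exact min_le_left _ _
      have hk3 : τ (k + 1) ≤ T := by rw [hτ]; exact (min_le_right _ _).trans ht
      filter_upwards [ih, hX.ae_step hT hN hb hK hL0 hk1 hk2 hk3] with ω h1 h2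
      rw [← h1, e1, h2]

end EulerScheme

/-- Density bound for the Euler scheme: the continuous density of `X^N_t(x)` exists and is at most
`c p_α(t, x - y)`, where `c` depends only on `d`, `α`, `T` and (a bound `K` of) `‖b‖_∞`. -/
theorem theorem4p2 (d : ℕ) (hd : 1 ≤ d) (α : ℝ) (hα : α ∈ Set.Ioo (1 : ℝ) 2)
    (T : ℝ≥0) (hT : 0 < T) (K : ℝ) :
    ∃ c : ℝ, 0 < c ∧
      ∀ (Ω : Type*) [MeasurableSpace Ω] (P : Measure Ω) [IsProbabilityMeasure P]
        (L : ℝ≥0 → Ω → EuclideanSpace ℝ (Fin d)), IsStableProcess α L P →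
      ∀ b : ℝ≥0 → EuclideanSpace ℝ (Fin d) → EuclideanSpace ℝ (Fin d),
        Measurable (Function.uncurry b) → (∀ s x, ‖b s x‖ ≤ K) →
      ∀ (N : ℕ), 1 ≤ N → ∀ (x : EuclideanSpace ℝ (Fin d))
        (X : ℝ≥0 → Ω → EuclideanSpace ℝ (Fin d)), IsEulerScheme P b L T N x X →
      ∀ t : ℝ≥0, 0 < t → t ≤ T →
        ∃ p : EuclideanSpace ℝ (Fin d) → ℝ,
          Continuous p ∧ (∀ y, 0 ≤ p y) ∧
          HasLaw (X t) (volume.withDensity fun y => ENNReal.ofReal (p y)) P ∧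
          ∀ y, p y ≤ c * stableDensity d α t (x - y) := by
  have hα' : α ∈ Set.Ioo (0 : ℝ) 2 := ⟨by linarith [hα.1], hα.2⟩
  have hγ : 0 < 1 - 1 / α := by
    rw [sub_pos, div_lt_one hα'.1]; exact hα.1
  obtain ⟨A, hA, hlip⟩ := exists_stableDensity_add_le hd hα'
  refine ⟨Real.exp (A * |K| * ((T : ℝ) ^ (1 - 1 / α) / (1 - 1 / α))), Real.exp_pos _, ?_⟩
  intro Ω _ P _ L hL b hb hbK N hN x X hX t ht htT
  have hK : 0 ≤ K := (norm_nonneg _).trans (hbK 0 0)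
  rw [abs_of_nonneg hK]
  have hh : 0 < T / (N : ℝ≥0) := div_pos hT (by exact_mod_cast hN)
  let τ : ℕ → ℝ≥0 := fun k => min (k * (T / N)) t
  have hτ0 : τ 0 = 0 := by simp [τ]
  have hτmono : Monotone τ := fun i j hij => by
    simp only [τ]; gcongr
  have hτt (k : ℕ) : τ k ≤ t := min_le_right _ _
  -- the number of steps needed to reach `t`; the last one may be incomplete
  obtain ⟨n, hn⟩ : ∃ n : ℕ, ⌈t / (T / (N : ℝ≥0))⌉₊ = n + 1 :=
    Nat.exists_eq_succ_of_ne_zero (Nat.ceil_pos.2 (div_pos ht hh)).ne'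
  have hτn : τ n < t := by
    refine (min_le_left _ _).trans_lt ?_
    rw [← lt_div_iff₀ hh]
    exact Nat.lt_ceil.1 (by rw [hn]; exact n.lt_succ_self)
  have hτn1 : τ (n + 1) = t := by
    refine min_eq_right ?_
    rw [← div_le_iff₀ hh]
    exact Nat.ceil_le.1 hn.le
  let β : ℕ → EuclideanSpace ℝ (Fin d) → EuclideanSpace ℝ (Fin d) :=
    fun k => driftIncrement b (τ k) (τ (k + 1))
  let D : ℕ → Ω → EuclideanSpace ℝ (Fin d) := fun k ω => L (τ (k + 1)) ω - L (τ k) ω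
  have hβ (k : ℕ) : Measurable (β k) := measurable_driftIncrement hb (hτmono k.le_succ)
  have hβK (k : ℕ) (z : EuclideanSpace ℝ (Fin d)) : ‖β k z‖ ≤ K * ((τ (k + 1) : ℝ) - τ k) :=
    norm_driftIncrement_le hbK (hτmono k.le_succ) z
  have hD (k : ℕ) : Measurable (D k) := (hL.measurable _).sub (hL.measurable _)
  have hind : iIndepFun D P := hL.indep.nat hτmono
  have hDlaw (k : ℕ) : P.map (D k) = P.map (L (τ (k + 1) - τ k)) := by
    have h := (hL.stationary (τ k) (τ (k + 1) - τ k)).map_eq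
    rwa [add_tsub_cancel_of_le (hτmono k.le_succ)] at h
  let Y : ℕ → Ω → EuclideanSpace ℝ (Fin d) := fun k ω => eulerChain x β (fun i => D i ω) k
  have hY (k : ℕ) : Measurable (Y k) := measurable_eulerChain x hβ hD k
  have hm (k : ℕ) : Measurable fun z => z + β k z := measurable_id.add (hβ k)
  have hprob (k : ℕ) : IsProbabilityMeasure (P.map (Y k)) :=
    Measure.isProbabilityMeasure_map (hY k).aemeasurable
  have hμ (k : ℕ) : P.map (Y (k + 1))
      = ((P.map (Y k)).map fun z => z + β k z).conv (P.map (L (τ (k + 1) - τ k))) := by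
    have hi : IndepFun (fun ω => Y k ω + β k (Y k ω)) (D k) P :=
      (indepFun_eulerChain x hβ hD hind k).comp (hm k) measurable_id
    rw [Measure.map_map (hm k) (hY k), ← hDlaw]
    exact hi.map_add_eq_map_conv_map ((hm k).comp (hY k)) (hD k)
  have hμ0 : P.map (Y 0) = Measure.dirac x := by
    change P.map (fun _ => x) = _
    rw [Measure.map_const, measure_univ, one_smul]
  have hXY : X t =ᵐ[P] Y (n + 1) := by
    have h := hX.ae_eq_eulerChain hT hN hb hbK hL.zero htT (τ := τ) (fun k => rfl) (n + 1)
    rwa [hτn1] at h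
  have hδ : 0 < t - τ n := tsub_pos_of_lt hτn
  have hpm := Measure.isProbabilityMeasure_map (μ := P.map (Y n)) (hm n).aemeasurable
  refine ⟨fun y => ∫ z, stableDensity d α (t - τ n) (y - z) ∂((P.map (Y n)).map fun z => z + β n z),
    ?_, fun y => integral_nonneg fun z => stableDensity_nonneg hd hα' hδ _, ⟨?_, ?_⟩, fun y => ?_⟩
  · obtain ⟨B, hB⟩ := exists_stableDensity_le d α (t - τ n)
    have hc := continuous_stableDensity hd hα' hδ
    refine continuous_of_dominated (bound := fun _ => B) (fun y => ?_) (fun y => ?_)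
      (integrable_const B) (ae_of_all _ fun z => by fun_prop)
    · exact (hc.comp (by fun_prop)).aestronglyMeasurable
    · refine ae_of_all _ fun z => ?_
      rw [Real.norm_of_nonneg (stableDensity_nonneg hd hα' hδ _)]; exact hB _
  · exact (hY (n + 1)).aemeasurable.congr hXY.symm
  · obtain ⟨B, hB⟩ := exists_stableDensity_le d α (t - τ n)
    have hlaw := hL.map_eq_withDensity hd hα' hδ
    have hfin := hL.isProbabilityMeasure_map (t - τ n)
    rw [hlaw] at hfin
    rw [Measure.map_congr hXY, hμ, hτn1, hlaw]
    exact conv_withDensity_ofReal _ (continuous_stableDensity hd hα' hδ)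
      (stableDensity_nonneg hd hα' hδ) hB
  · refine (hL.integral_stableDensity_chain_le hd hα hA.le hlip hτ0 hτmono hτt hK hβ hβK hprob hμ0
      hμ y n hτn).trans ?_
    rw [← stableDensity_neg hd hα', neg_sub]
    refine mul_le_mul_of_nonneg_right (Real.exp_le_exp.2 ?_) (stableDensity_nonneg hd hα' ht _)
    refine mul_le_mul_of_nonneg_left ?_ (mul_nonneg hA.le hK)
    rw [hτn1, sub_self, Real.zero_rpow hγ.ne', sub_zero]
    gcongr
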